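/- Let $X,Y$ be (real or complex) Hilbert spaces and $T:X\to Y$ a bounded linear operator with $\ker T=\{0\}$ and $\ker T^*=\{0\}$; let $F_\lambda$ be the spectral family of $TT^*$. Let $\varphi,\kappa:(0,\infty)\to[0,\infty)$ be continuous and (weakly) increasing, $\kappa\not\equiv 0$, let $(\lambda,\alpha)\mapsto g_\alpha(\lambda)\in\mathbb R$ be continuous on $(0,\infty)^2$, and assume that there are constants $c_1,\dots,c_7>0$ such that the following structural conditions hold. 1. For all $\alpha,\lambda>0$: $0\le \lambda g_\alpha(\lambda)\le 1$ and $\sqrt\lambda\, g_\alpha(\lambda)\le c_1/\sqrt\alpha$. 2. For all $\alpha>0$ and $\lambda\in(0,\alpha)$: $1-\lambda g_\alpha(\lambda)\ge c_2$ and $c_3/\alpha\le g_\alpha(\lambda)\le c_4/\alpha$. 3. For every $\lambda>0$: $\inf_{\alpha\in(0,\|T\|]}\frac{(1-\lambda g_\alpha(\lambda))\,g_\alpha(\lambda)}{\alpha}>0$. 4. For all $\alpha>0$: $\sup_{\lambda>0}|\varphi(\lambda)(1-\lambda g_\alpha(\lambda))|\le c_5\varphi(\alpha)$ and $\sup_{\lambda>0}|\kappa(\lambda)\varphi(\lambda)(1-\lambda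 g_\alpha(\lambda))|\le c_6\kappa(\alpha)\varphi(\alpha)$. 5. For all $\alpha>0$: $\sup_{\lambda>\alpha}\kappa(\lambda)/\sqrt\lambda\le c_7\,\kappa(\alpha)/\sqrt\alpha$. 6. For every $c_8>0$ there are $c_9>0$ and $\delta_0>0$ such that $\varphi(c_8\delta)\le c_9\varphi(\delta)$ and $\kappa(c_8\delta)\le c_9\kappa(\delta)$ for all $\delta\in(0,\delta_0)$. Let $x\in\operatorname{Ran}(\varphi(T^*T))$, $f\in\operatorname{Ran}(\kappa(T^*T))$, $y=Tx\neq0$, and let $y^\delta\in Y$ satisfy $\|y^\delta-y\|\le\delta$ for $\delta\in(0,1)$. Assume the generalized Muckenhoupt-type noise condition: there are $c_{10},\delta_0>0$ such that for all $\delta\in(0,\delta_0)$ and all $\alpha>0$ $$\alpha^2\int_{(\alpha,\infty)}\lambda^{-1}\kappa^2(\lambda)\,d\|F_\lambda(y^\delta-y)\|^2\le c_{10}\int_{(0,\alpha]}\lambda\,\kappa^2(\lambda)\,d\|F_\lambda(y^\delta-y)\|^2 .$$ Put $x_\alpha^\delta=g_\alpha(T^*T)T^*y^\delta$, $$\psi(\alpha,y^\delta)=\|(I-T^*Tg_\alpha(T^*T))x_\alpha^\delta\|,\qquad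 \psi_\kappa(\alpha,y^\delta)=\|\kappa(T^*T)(I-T^*Tg_\alpha(T^*T))x_\alpha^\delta\|,$$ and $\theta(t)=\varphi(t)\sqrt t$ for $t>0$, with inverse function $\theta^{-1}$. Fix $a\in(0,\|T\|]$, and let $\alpha(y^\delta)$ and $\alpha_\kappa(y^\delta)$ denote any minimizers over $\alpha\in(0,a]$ of $\psi(\cdot,y^\delta)$ and of $\psi_\kappa(\cdot,y^\delta)$, respectively. Then, as $\delta\to0$ (over those $\delta$ for which the minimizer in question exists, and with constants that depend neither on $\delta$ nor on the choice of the minimizer), where $\vee$ is the maximum, $$\|x^\delta_{\alpha(y^\delta)}-x\|=O\bigl(\varphi(\varphi(\theta^{-1}(\delta)))\vee\varphi(\theta^{-1}(\delta))\bigr),$$ $$|\langle f,x^\delta_{\alpha(y^\delta)}-x\rangle|=O\bigl((\kappa\varphi)(\varphi(\theta^{-1}(\delta)))\vee\varphi(\theta^{-1}(\delta))\bigr),$$ $$|\langle f,x^\delta_{\alpha_\kappa(y^\delta)}-x\rangle|=O\bigl((\kappa\varphi)((\kappa\varphi)(\theta^{-1}(\delta)))\vee(\kappa\varphi)(\theta^{-1}(\delta))\bigr).$$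 -/

import Mathlib

open Set Filter Topology MeasureTheory

namespace FunctionalStrategy

noncomputable section

section SpectralCalculus

variable {𝕜 H : Type*} [RCLike 𝕜] [NormedAddCommGroup H] [InnerProductSpace 𝕜 H]

/-- `μ` is the scalar spectral measure `d‖E_t v‖²` of the bounded positive self-adjoint
operator `A` at the vector `v`, where `E_t` is the spectral family of `A`: the finite Borel measure
carried by `[0, ‖A‖]` with `∫ tⁿ d‖E_t v‖² = ⟨v, Aⁿ v⟩` for all `n`. A compactly supported measure
is determined by its moments, so there is at most one such measure; for positive `A` it exists by
the spectral theorem. -/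
def IsSpectralMeasure (A : H →L[𝕜] H) (v : H) (μ : Measure ℝ) : Prop :=
  IsFiniteMeasure μ ∧ μ (Icc 0 ‖A‖)ᶜ = 0 ∧
    ∀ n : ℕ, ∫ t, t ^ n ∂μ = RCLike.re (inner 𝕜 v ((A ^ n) v))

/-- The scalar spectral measure `d‖E_t v‖²` of the positive operator `A` at `v`. -/
def spectralMeasure (A : H →L[𝕜] H) (v : H) : Measure ℝ :=
  Classical.epsilon (IsSpectralMeasure A v)

variable [CompleteSpace H]

/-- `B = h(A) = ∫ h(t) dE_t`, for a real Borel function `h` that is bounded on the spectrum of the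
positive operator `A`: the self-adjoint operator with `⟨v, B v⟩ = ∫ h(t) d‖E_t v‖²` for all `v`
(unique, since a self-adjoint operator is determined by its quadratic form). -/
def IsFunctionOf (A : H →L[𝕜] H) (h : ℝ → ℝ) (B : H →L[𝕜] H) : Prop :=
  IsSelfAdjoint B ∧
    ∀ v : H, RCLike.re (inner 𝕜 v (B v)) = ∫ t, h t ∂(spectralMeasure A v)

/-- The operator `h(A)` of the bounded Borel functional calculus of the positive operator `A`. -/
def funCalc (A : H →L[𝕜] H) (h : ℝ → ℝ) : H →L[𝕜] H :=
  Classical.epsilon (IsFunctionOf A h)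

end SpectralCalculus

/-- Continuous, non-negative, (weakly) increasing functions on `(0, ∞)`;
values at `t ≤ 0` are irrelevant. -/
structure IsIndexFunction (φ : ℝ → ℝ) : Prop where
  continuousOn : ContinuousOn φ (Ioi 0)
  nonneg : ∀ t, 0 < t → 0 ≤ φ t
  monotoneOn : MonotoneOn φ (Ioi 0)

/-- `θ(t) = φ(t) √t`. -/
def theta (φ : ℝ → ℝ) (t : ℝ) : ℝ := φ t * √t

/-- The inverse function of `θ : (0, ∞) → (0, ∞)`. -/
def thetaInv (φ : ℝ → ℝ) (δ : ℝ) : ℝ := Function.invFunOn (theta φ) (Ioi 0) δ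

section Regularization

variable {𝕜 X Y : Type*} [RCLike 𝕜]
  [NormedAddCommGroup X] [InnerProductSpace 𝕜 X] [CompleteSpace X]
  [NormedAddCommGroup Y] [InnerProductSpace 𝕜 Y] [CompleteSpace Y]

/-- `T* T` on `X`. -/
def TstarT (T : X →L[𝕜] Y) : X →L[𝕜] X := ContinuousLinearMap.adjoint T ∘L T

/-- `T T*` on `Y`. -/
def TTstar (T : X →L[𝕜] Y) : Y →L[𝕜] Y := T ∘L ContinuousLinearMap.adjoint T

/-- The regularized solution `g_α(T*T) T* z` for the data `z`; here `g α t` stands for `g_α(t)`. -/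
def regSol (T : X →L[𝕜] Y) (g : ℝ → ℝ → ℝ) (α : ℝ) (z : Y) : X :=
  funCalc (TstarT T) (g α) (ContinuousLinearMap.adjoint T z)

/-- `(I - T*T g_α(T*T)) g_α(T*T) T* z`. -/
def qoResidual (T : X →L[𝕜] Y) (g : ℝ → ℝ → ℝ) (α : ℝ) (z : Y) : X :=
  regSol T g α z - TstarT T (funCalc (TstarT T) (g α) (regSol T g α z))

/-- The quasi-optimality functional `ψ(α, z)`. -/
def psi (T : X →L[𝕜] Y) (g : ℝ → ℝ → ℝ) (α : ℝ) (z : Y) : ℝ :=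
  ‖qoResidual T g α z‖

/-- The modified quasi-optimality functional `ψ_κ(α, z)`. -/
def psiKappa (T : X →L[𝕜] Y) (g : ℝ → ℝ → ℝ) (κ : ℝ → ℝ) (α : ℝ) (z : Y) : ℝ :=
  ‖funCalc (TstarT T) κ (qoResidual T g α z)‖

/-- `α` is a minimizer of `F` over the parameter interval `(0, a]`. -/
def IsArgmin (F : ℝ → ℝ) (a α : ℝ) : Prop :=
  α ∈ Ioc 0 a ∧ ∀ β ∈ Ioc 0 a, F α ≤ F β

/-- The structural conditions on the filter functions `g_α` and the index functions `φ`, `κ`. -/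
structure StructuralAssumption (T : X →L[𝕜] Y) (g : ℝ → ℝ → ℝ) (φ κ : ℝ → ℝ) : Prop where
  filter_range : ∀ α > 0, ∀ t > 0, 0 ≤ t * g α t ∧ t * g α t ≤ 1
  filter_sqrt : ∃ c₁ > 0, ∀ α > 0, ∀ t > 0, √t * g α t ≤ c₁ / √α
  residual_lower : ∃ c₂ > 0, ∀ α > 0, ∀ t ∈ Ioo 0 α, c₂ ≤ 1 - t * g α t
  filter_two_sided : ∃ c₃ > 0, ∃ c₄ > 0, ∀ α > 0, ∀ t ∈ Ioo 0 α,
    c₃ / α ≤ g α t ∧ g α t ≤ c₄ / α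
  lower_qualification : ∀ t > 0,
    0 < ⨅ α : Ioc (0 : ℝ) ‖T‖, (1 - t * g α t) * g α t / (α : ℝ)
  qualification : ∃ c₅ > 0, ∀ α > 0, ∀ t > 0, |φ t * (1 - t * g α t)| ≤ c₅ * φ α
  qualification_kappa : ∃ c₆ > 0, ∀ α > 0, ∀ t > 0,
    |κ t * φ t * (1 - t * g α t)| ≤ c₆ * (κ α * φ α)
  kappa_covered : ∃ c₇ > 0, ∀ α > 0, ∀ t > α, κ t / √t ≤ c₇ * (κ α / √α)
  regular_variation : ∀ c₈ > 0, ∃ c₉ > 0, ∃ δ₀ > 0, ∀ δ ∈ Ioo 0 δ₀,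
    φ (c₈ * δ) ≤ c₉ * φ δ ∧ κ (c₈ * δ) ≤ c₉ * κ δ

/-- The generalized Muckenhoupt-type noise condition for noisy data `yδ δ` of `y`; the measure is
`d‖F_t (y^δ - y)‖²` with `F_t` the spectral family of `T T*`. -/
def NoiseCondition (T : X →L[𝕜] Y) (κ : ℝ → ℝ) (y : Y) (yδ : ℝ → Y) : Prop :=
  ∃ c₁₀ > 0, ∃ δ₀ > 0, ∀ δ ∈ Ioo 0 δ₀, ∀ α > 0,
    α ^ 2 * ∫ t in Ioi α, t⁻¹ * κ t ^ 2 ∂(spectralMeasure (TTstar T) (yδ δ - y))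
      ≤ c₁₀ * ∫ t in Ioc 0 α, t * κ t ^ 2 ∂(spectralMeasure (TTstar T) (yδ δ - y))

end Regularization

end

end FunctionalStrategy

/-!
Put `A = T*T`, let `x = φ(A) w` be the solution, `e = yδ - y` the noise and `s = θ⁻¹(δ)`, so that
`δ = φ(s) √s`. With weights `κ` for the error and `ω` for the functional, where `κ / ω` is
monotone, the three claims are the cases `(κ, ω) = (1, 1), (κ, 1), (κ, κ)` of one estimate.

* At `α = s` both parts of `ψ_ω`, from the noise and from the exact data, are `O(ω(s) φ(s))`, hence
  so is the minimum `ψ_ω(α*, yδ)`.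
* Since `T* y ≠ 0`, the lower qualification gives `ψ_ω(α, yδ) ≥ c α` for `yδ` near `y`, so
  `α* = O(ω(s) φ(s))`, and the bias `O(κ(α*) φ(α*))` of the regularized solution is controlled by
  regular variation.
* The Muckenhoupt condition moves the spectral mass of `e` above `α` below `α`, where the filter of
  `ψ_ω` is of order `1 / α`; so `ψ_ω(α, e)` dominates the propagated noise.
-/

namespace FunctionalStrategy

open ProbabilityTheory
open scoped InnerProductSpace

noncomputable section

/-! ### The spectral measure -/

section TruncatedMoments

/-- By weak compactness of the probability measures on `[a, b]`, a moment problem is solvable as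
soon as each of its finite truncations is. -/
lemma exists_probabilityMeasure_of_truncated_moments {a b : ℝ} {m : ℕ → ℝ}
    (h : ∀ N, ∃ P : ProbabilityMeasure (Icc a b), ∀ k ≤ N, ∫ t : Icc a b, (t : ℝ) ^ k ∂P = m k) :
    ∃ P : ProbabilityMeasure (Icc a b), ∀ k, ∫ t : Icc a b, (t : ℝ) ^ k ∂P = m k := by
  let S (N : ℕ) : Set (ProbabilityMeasure (Icc a b)) :=
    {P | ∀ k ≤ N, ∫ t : Icc a b, (t : ℝ) ^ k ∂P = m k}
  have isClosed_S (N : ℕ) : IsClosed (S N) := by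
    simp only [S, Set.ofPred_forall]
    refine isClosed_iInter fun k => isClosed_iInter fun _ => isClosed_eq ?_ continuous_const
    exact ProbabilityMeasure.continuous_integral_boundedContinuousFunction
      (BoundedContinuousFunction.mkOfCompact ⟨fun t : Icc a b => (t : ℝ) ^ k, by fun_prop⟩)
  obtain ⟨P, hP⟩ := IsCompact.nonempty_iInter_of_sequence_nonempty_isCompact_isClosed S
    (fun N P hP k hk => hP k (hk.trans N.le_succ)) h (isClosed_S 0).isCompact isClosed_S
  exact ⟨P, fun k => mem_iInter.1 hP k k le_rfl⟩

lemma exists_probabilityMeasure_of_weights {ι E : Type*} [Fintype ι] [MeasurableSpace E]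
    {w : ι → ℝ} (hw : ∀ i, 0 ≤ w i) (hw_sum : ∑ i, w i = 1) (p : ι → E) :
    ∃ P : ProbabilityMeasure E, ∀ f : E → ℝ, StronglyMeasurable f →
      ∫ t, f t ∂P = ∑ i, w i * f (p i) := by
  let P : Measure E := ∑ i, ENNReal.ofReal (w i) • Measure.dirac (p i)
  have hP : IsProbabilityMeasure P := ⟨by
    simp only [P, Measure.coe_finsetSum, Finset.sum_apply, Measure.smul_apply, measure_univ,
      smul_eq_mul, mul_one]
    rw [← ENNReal.ofReal_sum_of_nonneg fun i _ => hw i, hw_sum, ENNReal.ofReal_one]⟩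
  refine ⟨⟨P, hP⟩, fun f hf => ?_⟩
  have integrable_dirac (i : ι) : Integrable f (ENNReal.ofReal (w i) • Measure.dirac (p i)) :=
    (integrable_dirac' hf (by simp)).smul_measure ENNReal.ofReal_ne_top
  change ∫ t, f t ∂P = _
  rw [integral_finsetSum_measure fun i _ => integrable_dirac i]
  refine Finset.sum_congr rfl fun i _ => ?_
  rw [integral_smul_measure, integral_dirac' f (p i) hf, ENNReal.toReal_ofReal (hw i), smul_eq_mul]

end TruncatedMoments

section Existence

variable {𝕜 H : Type*} [RCLike 𝕜] [NormedAddCommGroup H] [InnerProductSpace 𝕜 H]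

lemma re_inner_pow_eq_sum_eigenvalues [FiniteDimensional 𝕜 H] {B : H →ₗ[𝕜] H} (hB : B.IsSymmetric)
    {n : ℕ} (hn : Module.finrank 𝕜 H = n) (v : H) (k : ℕ) :
    RCLike.re ⟪v, (B ^ k) v⟫_𝕜
      = ∑ i, ‖⟪hB.eigenvectorBasis hn i, v⟫_𝕜‖ ^ 2 * hB.eigenvalues hn i ^ k := by
  let b := hB.eigenvectorBasis hn
  have inner_pow (i : Fin n) :
      ⟪b i, (B ^ k) v⟫_𝕜 = (hB.eigenvalues hn i : 𝕜) ^ k * ⟪b i, v⟫_𝕜 := by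
    induction k with
    | zero => simp
    | succ k ih =>
      rw [pow_succ', Module.End.mul_apply, ← hB, hB.apply_eigenvectorBasis, inner_smul_left, ih,
        RCLike.conj_ofReal, pow_succ', mul_assoc]
  rw [← b.sum_inner_mul_inner, map_sum]
  refine Finset.sum_congr rfl fun i _ => ?_
  rw [inner_pow, mul_left_comm, ← inner_conj_symm v (b i), RCLike.conj_mul, ← RCLike.ofReal_pow,
    ← RCLike.ofReal_pow, ← RCLike.ofReal_mul, RCLike.ofReal_re, mul_comm]

/-- The compression `P_K A|_K` of the operator `A` to the subspace `K`. -/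
def compression (A : H →L[𝕜] H) (K : Submodule 𝕜 H) [K.HasOrthogonalProjection] : K →ₗ[𝕜] K :=
  (K.orthogonalProjectionOnto ∘L A ∘L K.subtypeL : K →L[𝕜] K)

section Compression

variable {A : H →L[𝕜] H} {K : Submodule 𝕜 H} [K.HasOrthogonalProjection]

lemma inner_compression_right (u w : K) : ⟪u, compression A K w⟫_𝕜 = ⟪(u : H), A w⟫_𝕜 :=
  Submodule.inner_orthogonalProjectionOnto_eq_of_mem_left u (A w)

lemma inner_compression_left (u w : K) : ⟪compression A K u, w⟫_𝕜 = ⟪A u, (w : H)⟫_𝕜 :=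
  Submodule.inner_orthogonalProjectionOnto_eq_of_mem_right w (A u)

lemma isSymmetric_compression (hA : (A : H →ₗ[𝕜] H).IsSymmetric) :
    (compression A K).IsSymmetric := fun u w => by
  rw [inner_compression_left, inner_compression_right]
  exact hA u w

lemma coe_compression_pow {v : K} {N : ℕ} (h : ∀ k ≤ N, (A ^ k) (v : H) ∈ K) :
    ∀ k ≤ N, ((compression A K ^ k) v : H) = (A ^ k) (v : H) := by
  intro k
  induction k with
  | zero => simp
  | succ k ih =>
    intro hk
    have pow_succ_apply : A ((A ^ k) (v : H)) = (A ^ (k + 1)) (v : H) := by rw [pow_succ']; rfl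
    rw [pow_succ', Module.End.mul_apply]
    change ((K.orthogonalProjectionOnto (A ((compression A K ^ k) v)) : K) : H) = _
    rw [ih (Nat.le_of_succ_le hk), pow_succ_apply]
    exact Submodule.starProjection_eq_self_iff.2 (h _ hk)

lemma eigenvalues_compression_mem_Icc [FiniteDimensional 𝕜 K] (hA : A.IsPositive) {n : ℕ}
    (hn : Module.finrank 𝕜 K = n) (i : Fin n) :
    (isSymmetric_compression (K := K) hA.isSymmetric).eigenvalues hn i ∈ Icc 0 ‖A‖ := by
  set hB := isSymmetric_compression (K := K) hA.isSymmetric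
  set u : H := (hB.eigenvectorBasis hn i : H)
  have norm_u : ‖u‖ = 1 := (hB.eigenvectorBasis hn).orthonormal.1 i
  have rayleigh : RCLike.re ⟪u, A u⟫_𝕜 = hB.eigenvalues hn i := by
    rw [← inner_compression_right, hB.apply_eigenvectorBasis, inner_smul_right]
    simp
  rw [← rayleigh]
  refine ⟨hA.re_inner_nonneg_right u, ?_⟩
  calc RCLike.re ⟪u, A u⟫_𝕜 ≤ ‖u‖ * ‖A u‖ := re_inner_le_norm u (A u)
    _ ≤ ‖A‖ := by simpa [norm_u] using A.le_opNorm u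

end Compression

/-- The measure is the spectral measure of the compression of `A` to the Krylov space
`span {v, A v, …, A ^ N v}`. -/
lemma exists_truncated_spectralMeasure {A : H →L[𝕜] H} (hA : A.IsPositive) {v : H} (hv : ‖v‖ = 1)
    (N : ℕ) : ∃ P : ProbabilityMeasure (Icc 0 ‖A‖),
      ∀ k ≤ N, ∫ t : Icc 0 ‖A‖, (t : ℝ) ^ k ∂P = RCLike.re ⟪v, (A ^ k) v⟫_𝕜 := by
  classical
  let K : Submodule 𝕜 H :=
    Submodule.span 𝕜 (((Finset.range (N + 1)).image fun k => (A ^ k) v : Finset H) : Set H)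
  have : FiniteDimensional 𝕜 K := FiniteDimensional.span_finset 𝕜 _
  have pow_mem (k : ℕ) (hk : k ≤ N) : (A ^ k) v ∈ K := Submodule.subset_span <|
    Finset.mem_coe.2 (Finset.mem_image_of_mem _ (Finset.mem_range_succ_iff.2 hk))
  let v' : K := ⟨v, pow_mem 0 N.zero_le⟩
  have hB := isSymmetric_compression (K := K) hA.isSymmetric
  let b := hB.eigenvectorBasis rfl
  have sum_weights : ∑ i, ‖⟪b i, v'⟫_𝕜‖ ^ 2 = 1 := by
    rw [b.sum_sq_norm_inner_right, show ‖v'‖ = 1 from hv, one_pow]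
  obtain ⟨P, hP⟩ := exists_probabilityMeasure_of_weights (fun i => by positivity) sum_weights
    fun i =>
      (⟨hB.eigenvalues rfl i, eigenvalues_compression_mem_Icc hA rfl i⟩ : Icc 0 ‖A‖)
  refine ⟨P, fun k hk => ?_⟩
  rw [hP _ (by fun_prop), ← coe_compression_pow (v := v') pow_mem k hk]
  exact (re_inner_pow_eq_sum_eigenvalues hB rfl v' k).symm

lemma IsSpectralMeasure.smul {A : H →L[𝕜] H} {v : H} {μ : Measure ℝ}
    (hμ : IsSpectralMeasure A v μ) (c : ℝ) :
    IsSpectralMeasure A ((c : 𝕜) • v) (ENNReal.ofReal (c ^ 2) • μ) := by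
  obtain ⟨_, hsupp, hmom⟩ := hμ
  refine ⟨Measure.smul_finite _ ENNReal.ofReal_ne_top, by simp [hsupp], fun n => ?_⟩
  rw [integral_smul_measure, hmom, ENNReal.toReal_ofReal (sq_nonneg c), map_smul, inner_smul_left,
    inner_smul_right, RCLike.conj_ofReal, RCLike.re_ofReal_mul, RCLike.re_ofReal_mul, smul_eq_mul,
    sq, mul_assoc]

lemma exists_isSpectralMeasure_of_norm_eq_one {A : H →L[𝕜] H} (hA : A.IsPositive) {v : H}
    (hv : ‖v‖ = 1) : ∃ μ, IsSpectralMeasure A v μ := by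
  obtain ⟨P, hP⟩ := exists_probabilityMeasure_of_truncated_moments
    (exists_truncated_spectralMeasure hA hv)
  refine ⟨(P : Measure (Icc 0 ‖A‖)).map (↑), inferInstance, ?_, fun n => ?_⟩
  · rw [Measure.map_apply measurable_subtype_coe measurableSet_Icc.compl, preimage_compl,
      Subtype.coe_preimage_self, compl_univ, measure_empty]
  · rw [integral_map measurable_subtype_coe.aemeasurable (by fun_prop), hP]

lemma exists_isSpectralMeasure {A : H →L[𝕜] H} (hA : A.IsPositive) (v : H) :
    ∃ μ, IsSpectralMeasure A v μ := by
  rcases eq_or_ne v 0 with rfl | hv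
  · exact ⟨0, inferInstance, by simp, by simp⟩
  have norm_ne : ‖v‖ ≠ 0 := norm_ne_zero_iff.2 hv
  obtain ⟨μ, hμ⟩ := exists_isSpectralMeasure_of_norm_eq_one hA
    (v := ((‖v‖⁻¹ : ℝ) : 𝕜) • v) (by rw [norm_smul]; simp [norm_ne])
  have rescaled := hμ.smul ‖v‖
  rw [smul_smul, ← RCLike.ofReal_mul, mul_inv_cancel₀ norm_ne, RCLike.ofReal_one, one_smul]
    at rescaled
  exact ⟨_, rescaled⟩

lemma isSpectralMeasure_spectralMeasure {A : H →L[𝕜] H} (hA : A.IsPositive) (v : H) :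
    IsSpectralMeasure A v (spectralMeasure A v) :=
  Classical.epsilon_spec (exists_isSpectralMeasure hA v)

end Existence

section Moments

variable {μ ν : Measure ℝ} [IsFiniteMeasure μ] [IsFiniteMeasure ν]

lemma integrable_of_ae_mem_Icc {a b : ℝ} (hμ : ∀ᵐ t ∂μ, t ∈ Icc a b) {f : ℝ → ℝ}
    (hf : Continuous f) : Integrable f μ := by
  rw [← Measure.restrict_eq_self_of_ae_mem hμ]
  exact hf.continuousOn.integrableOn_Icc

/-- The moments are the Taylor coefficients at `0` of the moment generating function. -/
lemma measure_ext_of_moments (hμ : ∀ s, Integrable (fun t => Real.exp (s * t)) μ)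
    (hν : ∀ s, Integrable (fun t => Real.exp (s * t)) ν)
    (h : ∀ n : ℕ, ∫ t, t ^ n ∂μ = ∫ t, t ^ n ∂ν) : μ = ν := by
  have setμ : integrableExpSet id μ = univ := eq_univ_of_forall hμ
  have setν : integrableExpSet id ν = univ := eq_univ_of_forall hν
  have mgf_near_zero : mgf id μ =ᶠ[𝓝 0] mgf id ν := by
    have seriesμ := hasFPowerSeriesAt_mgf (X := id) (μ := μ) (v := 0) (by simp [setμ])
    have seriesν := hasFPowerSeriesAt_mgf (X := id) (μ := ν) (v := 0) (by simp [setν])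
    filter_upwards [seriesμ.eventually_hasSum, seriesν.eventually_hasSum] with s hs₁ hs₂
    simp only [id, zero_mul, Real.exp_zero, mul_one, h, zero_add] at hs₁ hs₂
    exact hs₁.unique hs₂
  have mgf_eq : mgf id μ = mgf id ν := AnalyticOnNhd.eq_of_eventuallyEq
    (by simpa [setμ] using analyticOnNhd_mgf (X := id) (μ := μ))
    (by simpa [setν] using analyticOnNhd_mgf (X := id) (μ := ν)) mgf_near_zero
  have zero_iff : μ = 0 ↔ ν = 0 := by
    have mass_eq : μ.real univ = ν.real univ := by simpa using h 0
    rw [← Measure.measure_univ_eq_zero, ← measureReal_eq_zero_iff, mass_eq,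
      measureReal_eq_zero_iff, Measure.measure_univ_eq_zero]
  exact Measure.ext_of_complexMGF_id_eq (funext fun z =>
    eqOn_complexMGF_of_mgf' mgf_eq zero_iff (by simp [setμ]))

end Moments

/-! ### Functional calculus -/

section PolynomialCalculus

variable {𝕜 H : Type*} [RCLike 𝕜] [NormedAddCommGroup H] [InnerProductSpace 𝕜 H]

/-- The operator `p(A)` for a real polynomial `p`. -/
def polyOp (A : H →L[𝕜] H) : Polynomial ℝ →+* (H →L[𝕜] H) :=
  (Polynomial.aeval A : Polynomial 𝕜 →ₐ[𝕜] (H →L[𝕜] H)).toRingHom.comp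
    (Polynomial.mapRingHom (algebraMap ℝ 𝕜))

lemma polyOp_apply (A : H →L[𝕜] H) (p : Polynomial ℝ) :
    polyOp A p = Polynomial.aeval A (p.map (algebraMap ℝ 𝕜)) := rfl

lemma polyOp_monomial (A : H →L[𝕜] H) (n : ℕ) (c : ℝ) :
    polyOp A (Polynomial.monomial n c) = (c : 𝕜) • A ^ n := by
  rw [polyOp_apply, Polynomial.map_monomial, Polynomial.aeval_monomial,
    Algebra.algebraMap_eq_smul_one, smul_mul_assoc, one_mul]

lemma polyOp_X (A : H →L[𝕜] H) : polyOp A Polynomial.X = A := by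
  simp [polyOp_apply]

variable {A : H →L[𝕜] H}

lemma inner_pow_left (hA : (A : H →ₗ[𝕜] H).IsSymmetric) (n : ℕ) (v w : H) :
    ⟪(A ^ n) v, w⟫_𝕜 = ⟪v, (A ^ n) w⟫_𝕜 := by
  have isSymmetric_pow := hA.pow n
  rw [← ContinuousLinearMap.toLinearMap_pow] at isSymmetric_pow
  exact isSymmetric_pow v w

lemma inner_polyOp_left (hA : (A : H →ₗ[𝕜] H).IsSymmetric) (p : Polynomial ℝ) (v w : H) :
    ⟪polyOp A p v, w⟫_𝕜 = ⟪v, polyOp A p w⟫_𝕜 := by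
  induction p using Polynomial.induction_on' with
  | add p q hp hq => simp only [map_add, add_apply, inner_add_left, inner_add_right, hp, hq]
  | monomial n c =>
    rw [polyOp_monomial, smul_apply, smul_apply, inner_smul_left, inner_smul_right,
      inner_pow_left hA, RCLike.conj_ofReal]

lemma isFiniteMeasure_spectralMeasure (hA : A.IsPositive) (v : H) :
    IsFiniteMeasure (spectralMeasure A v) :=
  (isSpectralMeasure_spectralMeasure hA v).1

lemma ae_mem_Icc_spectralMeasure (hA : A.IsPositive) (v : H) :
    ∀ᵐ t ∂(spectralMeasure A v), t ∈ Icc 0 ‖A‖ :=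
  ae_iff.2 (isSpectralMeasure_spectralMeasure hA v).2.1

lemma integral_pow_spectralMeasure (hA : A.IsPositive) (v : H) (n : ℕ) :
    ∫ t, t ^ n ∂(spectralMeasure A v) = RCLike.re ⟪v, (A ^ n) v⟫_𝕜 :=
  (isSpectralMeasure_spectralMeasure hA v).2.2 n

lemma integrable_spectralMeasure_of_continuous (hA : A.IsPositive) (v : H) {h : ℝ → ℝ}
    (hh : Continuous h) : Integrable h (spectralMeasure A v) :=
  have := isFiniteMeasure_spectralMeasure hA v
  integrable_of_ae_mem_Icc (ae_mem_Icc_spectralMeasure hA v) hh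

lemma spectralMeasure_real_univ (hA : A.IsPositive) (v : H) :
    (spectralMeasure A v).real univ = ‖v‖ ^ 2 := by
  simpa using integral_pow_spectralMeasure hA v 0

lemma IsSpectralMeasure.eq (hA : A.IsPositive) {v : H} {μ : Measure ℝ}
    (hμ : IsSpectralMeasure A v μ) : spectralMeasure A v = μ := by
  have := isFiniteMeasure_spectralMeasure hA v
  obtain ⟨_, hsupp, hmom⟩ := hμ
  exact measure_ext_of_moments
    (fun s => integrable_spectralMeasure_of_continuous hA v (by fun_prop))
    (fun s => integrable_of_ae_mem_Icc (ae_iff.2 hsupp) (by fun_prop))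
    fun n => (integral_pow_spectralMeasure hA v n).trans (hmom n).symm

lemma spectralMeasure_parallelogram (hA : A.IsPositive) (v w : H) :
    spectralMeasure A (v + w) + spectralMeasure A (v - w)
      = (2 : NNReal) • (spectralMeasure A v + spectralMeasure A w) := by
  have finite (u : H) := isFiniteMeasure_spectralMeasure hA u
  have integrable (u : H) {h : ℝ → ℝ} (hh : Continuous h) :=
    integrable_spectralMeasure_of_continuous hA u hh
  refine measure_ext_of_moments
    (fun s => (integrable _ (by fun_prop)).add_measure (integrable _ (by fun_prop)))
    (fun s => ((integrable _ (by fun_prop)).add_measure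
      (integrable _ (by fun_prop))).smul_measure_nnreal) fun n => ?_
  have integrable_pow (u : H) := integrable u (continuous_pow n)
  rw [integral_add_measure (integrable_pow _) (integrable_pow _), integral_smul_nnreal_measure,
    integral_add_measure (integrable_pow _) (integrable_pow _)]
  simp only [integral_pow_spectralMeasure hA, map_sub, map_add, inner_sub_left, inner_sub_right,
    inner_add_left, inner_add_right, NNReal.smul_def, NNReal.coe_ofNat, smul_eq_mul]
  ring

lemma re_inner_polyOp (hA : A.IsPositive) (p : Polynomial ℝ) (v : H) :
    RCLike.re ⟪v, polyOp A p v⟫_𝕜 = ∫ t, p.eval t ∂(spectralMeasure A v) := by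
  induction p using Polynomial.induction_on' with
  | add p q hp hq =>
    simp only [map_add, add_apply, inner_add_right, hp, hq, Polynomial.eval_add]
    rw [integral_add (integrable_spectralMeasure_of_continuous hA v p.continuous)
      (integrable_spectralMeasure_of_continuous hA v q.continuous)]
  | monomial n c =>
    simp only [Polynomial.eval_monomial, integral_const_mul, integral_pow_spectralMeasure hA,
      polyOp_monomial]
    rw [smul_apply, inner_smul_right, RCLike.re_ofReal_mul]

lemma norm_polyOp_sq (hA : A.IsPositive) (p : Polynomial ℝ) (v : H) :
    ‖polyOp A p v‖ ^ 2 = ∫ t, p.eval t ^ 2 ∂(spectralMeasure A v) := by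
  simp_rw [← Polynomial.eval_pow]
  rw [← re_inner_polyOp hA, sq p, map_mul, mul_apply_eq_comp, ← inner_polyOp_left hA.isSymmetric,
    inner_self_eq_norm_sq_to_K, ← RCLike.ofReal_pow, RCLike.ofReal_re]

end PolynomialCalculus

section PolyLimit

variable {𝕜 H : Type*} [RCLike 𝕜] [NormedAddCommGroup H] [InnerProductSpace 𝕜 H]

/-- The polynomials `p n` are uniformly bounded on `[0, ‖A‖]` and converge to `h` almost everywhere
with respect to every scalar spectral measure of `A`; then `p n (A)` tends strongly to `h(A)`. -/
structure PolyLimit (A : H →L[𝕜] H) (h : ℝ → ℝ) (p : ℕ → Polynomial ℝ) : Prop where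
  bound : ∃ C, ∀ n, ∀ t ∈ Icc 0 ‖A‖, |(p n).eval t| ≤ C
  tendsto : ∀ v, ∀ᵐ t ∂(spectralMeasure A v), Tendsto (fun n => (p n).eval t) atTop (𝓝 (h t))

variable {A : H →L[𝕜] H} {h k : ℝ → ℝ} {p q : ℕ → Polynomial ℝ}

namespace PolyLimit

lemma const (A : H →L[𝕜] H) (p : Polynomial ℝ) : PolyLimit A (fun t => p.eval t) fun _ => p where
  bound := by
    obtain ⟨C, hC⟩ := isCompact_Icc.exists_bound_of_continuousOn
      (s := Icc 0 ‖A‖) (f := fun t => p.eval t) p.continuous.continuousOn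
    exact ⟨C, fun _ t ht => hC t ht⟩
  tendsto _ := .of_forall fun _ => tendsto_const_nhds

lemma add (hp : PolyLimit A h p) (hq : PolyLimit A k q) :
    PolyLimit A (fun t => h t + k t) fun n => p n + q n where
  bound := by
    obtain ⟨C, hC⟩ := hp.bound
    obtain ⟨D, hD⟩ := hq.bound
    refine ⟨C + D, fun n t ht => ?_⟩
    rw [Polynomial.eval_add]
    exact (abs_add_le _ _).trans (add_le_add (hC n t ht) (hD n t ht))
  tendsto v := by
    filter_upwards [hp.tendsto v, hq.tendsto v] with t tendsto_p tendsto_q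
    simpa only [Polynomial.eval_add] using tendsto_p.add tendsto_q

lemma mul (hp : PolyLimit A h p) (hq : PolyLimit A k q) :
    PolyLimit A (fun t => h t * k t) fun n => p n * q n where
  bound := by
    obtain ⟨C, hC⟩ := hp.bound
    obtain ⟨D, hD⟩ := hq.bound
    refine ⟨C * D, fun n t ht => ?_⟩
    rw [Polynomial.eval_mul, abs_mul]
    exact mul_le_mul (hC n t ht) (hD n t ht) (abs_nonneg _) ((abs_nonneg _).trans (hC n t ht))
  tendsto v := by
    filter_upwards [hp.tendsto v, hq.tendsto v] with t tendsto_p tendsto_q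
    simpa only [Polynomial.eval_mul] using tendsto_p.mul tendsto_q

lemma tendsto_integral (hA : A.IsPositive) (hp : PolyLimit A h p) (v : H) :
    Tendsto (fun n => ∫ t, (p n).eval t ∂(spectralMeasure A v)) atTop
      (𝓝 (∫ t, h t ∂(spectralMeasure A v))) := by
  obtain ⟨C, hC⟩ := hp.bound
  have := isFiniteMeasure_spectralMeasure hA v
  refine tendsto_integral_of_dominated_convergence (fun _ => C)
    (fun n => (p n).continuous.aestronglyMeasurable) (integrable_const C) (fun n => ?_)
    (hp.tendsto v)
  filter_upwards [ae_mem_Icc_spectralMeasure hA v] with t ht using hC n t ht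

lemma integrable (hA : A.IsPositive) (hp : PolyLimit A h p) (v : H) :
    Integrable h (spectralMeasure A v) := by
  obtain ⟨C, hC⟩ := hp.bound
  have := isFiniteMeasure_spectralMeasure hA v
  refine Integrable.of_bound (C := C) (aestronglyMeasurable_of_tendsto_ae atTop
    (fun n => (p n).continuous.aestronglyMeasurable) (hp.tendsto v)) ?_
  filter_upwards [ae_mem_Icc_spectralMeasure hA v, hp.tendsto v] with t ht tendsto_p
  exact le_of_tendsto tendsto_p.norm (.of_forall fun n => hC n t ht)

lemma tendsto_integral_sub_sq (hA : A.IsPositive) (hp : PolyLimit A h p) (v : H) :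
    Tendsto (fun m : ℕ × ℕ => ∫ t, (p m.1 - p m.2).eval t ^ 2 ∂(spectralMeasure A v))
      atTop (𝓝 0) := by
  obtain ⟨C, hC⟩ := hp.bound
  have := isFiniteMeasure_spectralMeasure hA v
  rw [← integral_zero ℝ ℝ (μ := spectralMeasure A v)]
  refine tendsto_integral_filter_of_dominated_convergence (fun _ => (C + C) ^ 2)
    (.of_forall fun m => ((p m.1 - p m.2).continuous.pow 2).aestronglyMeasurable)
    (.of_forall fun m => ?_) (integrable_const _) ?_
  · filter_upwards [ae_mem_Icc_spectralMeasure hA v] with t ht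
    rw [Polynomial.eval_sub, norm_pow]
    gcongr
    exact (norm_sub_le _ _).trans (add_le_add (hC _ t ht) (hC _ t ht))
  · filter_upwards [hp.tendsto v] with t tendsto_p
    rw [← prod_atTop_atTop_eq]
    simpa [Function.comp_def] using
      ((tendsto_p.comp tendsto_fst).sub (tendsto_p.comp tendsto_snd)).pow 2

lemma cauchySeq (hA : A.IsPositive) (hp : PolyLimit A h p) (v : H) :
    CauchySeq fun n => polyOp A (p n) v := by
  have tendsto_norm_sq := hp.tendsto_integral_sub_sq hA v
  simp only [← norm_polyOp_sq hA] at tendsto_norm_sq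
  rw [cauchySeq_iff_tendsto_dist_atTop_0]
  simpa [Function.comp_def, Real.sqrt_sq, dist_eq_norm] using
    (Real.continuous_sqrt.tendsto 0).comp tendsto_norm_sq

lemma exists_isFunctionOf [CompleteSpace H] (hA : A.IsPositive) (hp : PolyLimit A h p) :
    ∃ B : H →L[𝕜] H, IsFunctionOf A h B ∧
      ∀ v, Tendsto (fun n => polyOp A (p n) v) atTop (𝓝 (B v)) := by
  choose b hb using fun v => cauchySeq_tendsto_of_complete (hp.cauchySeq hA v)
  let B : H →L[𝕜] H := continuousLinearMapOfTendsto (fun n => polyOp A (p n)) (f := b)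
    (tendsto_pi_nhds.2 hb)
  have tendsto_B (v : H) : Tendsto (fun n => polyOp A (p n) v) atTop (𝓝 (B v)) := hb v
  refine ⟨B, ⟨?_, fun v => ?_⟩, tendsto_B⟩
  · rw [ContinuousLinearMap.isSelfAdjoint_iff_isSymmetric]
    intro v w
    refine tendsto_nhds_unique ((tendsto_B v).inner tendsto_const_nhds)
      (Tendsto.congr (fun n => ?_) (tendsto_const_nhds.inner (tendsto_B w)))
    exact (inner_polyOp_left hA.isSymmetric (p n) v w).symm
  · refine tendsto_nhds_unique ((RCLike.continuous_re.tendsto _).comp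
      ((tendsto_const_nhds (x := v)).inner (tendsto_B v)))
      ((hp.tendsto_integral hA v).congr fun n => ?_)
    rw [← re_inner_polyOp hA, Function.comp_apply]

end PolyLimit

variable [CompleteSpace H]

lemma IsFunctionOf.eq {B C : H →L[𝕜] H} (hB : IsFunctionOf A h B) (hC : IsFunctionOf A h C) :
    B = C := by
  have isSymmetric_sub : ((B - C : H →L[𝕜] H) : H →ₗ[𝕜] H).IsSymmetric :=
    ContinuousLinearMap.isSelfAdjoint_iff_isSymmetric.1 (hB.1.sub hC.1)
  have toLinearMap_sub_eq_zero : ((B - C : H →L[𝕜] H) : H →ₗ[𝕜] H) = 0 := by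
    refine isSymmetric_sub.inner_map_self_eq_zero.1 fun v => ?_
    rw [isSymmetric_sub, ← isSymmetric_sub.coe_re_inner_self_apply v, ContinuousLinearMap.coe_coe,
      sub_apply, inner_sub_right, map_sub, hB.2, hC.2, sub_self, RCLike.ofReal_zero]
  exact sub_eq_zero.1 (ContinuousLinearMap.coe_injective toLinearMap_sub_eq_zero)

lemma PolyLimit.tendsto_funCalc (hA : A.IsPositive) (hp : PolyLimit A h p) (v : H) :
    Tendsto (fun n => polyOp A (p n) v) atTop (𝓝 (funCalc A h v)) := by
  obtain ⟨B, hB, tendsto_B⟩ := hp.exists_isFunctionOf hA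
  have funCalc_eq : funCalc A h = B := IsFunctionOf.eq (Classical.epsilon_spec ⟨B, hB⟩) hB
  exact funCalc_eq ▸ tendsto_B v

end PolyLimit

section FunctionalCalculus

variable {𝕜 H : Type*} [RCLike 𝕜] [NormedAddCommGroup H] [InnerProductSpace 𝕜 H]
  {A : H →L[𝕜] H} {h k : ℝ → ℝ}

/-- The functions `h` for which `h(A)` is constructed here as a strong limit of polynomials in
`A`. -/
def Admissible (A : H →L[𝕜] H) (h : ℝ → ℝ) : Prop := ∃ p, PolyLimit A h p

namespace Admissible

lemma poly (A : H →L[𝕜] H) (p : Polynomial ℝ) : Admissible A fun t => p.eval t :=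
  ⟨_, PolyLimit.const A p⟩

lemma id (A : H →L[𝕜] H) : Admissible A fun t => t := by
  simpa using Admissible.poly A Polynomial.X

lemma const (A : H →L[𝕜] H) (c : ℝ) : Admissible A fun _ => c := by
  simpa using Admissible.poly A (Polynomial.C c)

lemma add (hh : Admissible A h) (hk : Admissible A k) : Admissible A fun t => h t + k t := by
  obtain ⟨p, hp⟩ := hh
  obtain ⟨q, hq⟩ := hk
  exact ⟨_, hp.add hq⟩

lemma mul (hh : Admissible A h) (hk : Admissible A k) : Admissible A fun t => h t * k t := by
  obtain ⟨p, hp⟩ := hh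
  obtain ⟨q, hq⟩ := hk
  exact ⟨_, hp.mul hq⟩

lemma sub (hh : Admissible A h) (hk : Admissible A k) : Admissible A fun t => h t - k t := by
  simpa [sub_eq_add_neg] using hh.add ((const A (-1)).mul hk)

lemma sq (hh : Admissible A h) : Admissible A fun t => h t ^ 2 := by
  simpa only [pow_two] using hh.mul hh

lemma integrable (hA : A.IsPositive) (hh : Admissible A h) (v : H) :
    Integrable h (spectralMeasure A v) := hh.choose_spec.integrable hA v

end Admissible

variable [CompleteSpace H]

lemma funCalc_poly (hA : A.IsPositive) (p : Polynomial ℝ) :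
    funCalc A (fun t => p.eval t) = polyOp A p := by
  ext v
  exact tendsto_nhds_unique ((PolyLimit.const A p).tendsto_funCalc hA v) tendsto_const_nhds

lemma funCalc_id (hA : A.IsPositive) : funCalc A (fun t => t) = A := by
  simpa [polyOp_X] using funCalc_poly hA Polynomial.X

lemma funCalc_one (hA : A.IsPositive) : funCalc A 1 = 1 := by
  simpa [← Pi.one_def] using funCalc_poly hA 1

lemma funCalc_zero (hA : A.IsPositive) : funCalc A (fun _ => 0) = 0 := by
  simpa using funCalc_poly hA 0

lemma funCalc_add (hA : A.IsPositive) (hh : Admissible A h) (hk : Admissible A k) (v : H) :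
    funCalc A (fun t => h t + k t) v = funCalc A h v + funCalc A k v := by
  obtain ⟨p, hp⟩ := hh
  obtain ⟨q, hq⟩ := hk
  refine tendsto_nhds_unique ((hp.add hq).tendsto_funCalc hA v)
    (((hp.tendsto_funCalc hA v).add (hq.tendsto_funCalc hA v)).congr fun n => ?_)
  rw [map_add, add_apply]

lemma funCalc_sub (hA : A.IsPositive) (hh : Admissible A h) (hk : Admissible A k) (v : H) :
    funCalc A (fun t => h t - k t) v = funCalc A h v - funCalc A k v := by
  rw [eq_sub_iff_add_eq, ← funCalc_add hA (hh.sub hk) hk]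
  simp only [sub_add_cancel]

lemma inner_funCalc_left (hA : A.IsPositive) (hh : Admissible A h) (v w : H) :
    ⟪funCalc A h v, w⟫_𝕜 = ⟪v, funCalc A h w⟫_𝕜 := by
  obtain ⟨p, hp⟩ := hh
  refine tendsto_nhds_unique ((hp.tendsto_funCalc hA v).inner tendsto_const_nhds)
    ((tendsto_const_nhds.inner (hp.tendsto_funCalc hA w)).congr fun n => ?_)
  exact (inner_polyOp_left hA.isSymmetric (p n) v w).symm

lemma norm_inner_funCalc_le (hA : A.IsPositive) (hh : Admissible A h) (v w : H) :
    ‖⟪funCalc A h v, w⟫_𝕜‖ ≤ ‖v‖ * ‖funCalc A h w‖ := by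
  rw [inner_funCalc_left hA hh]
  exact norm_inner_le_norm v _

lemma funCalc_mul (hA : A.IsPositive) (hh : Admissible A h) (hk : Admissible A k) (v : H) :
    funCalc A (fun t => h t * k t) v = funCalc A h (funCalc A k v) := by
  refine ext_inner_left 𝕜 fun w => ?_
  rw [← inner_funCalc_left hA hh]
  obtain ⟨p, hp⟩ := hh
  obtain ⟨q, hq⟩ := hk
  refine tendsto_nhds_unique (tendsto_const_nhds.inner ((hp.mul hq).tendsto_funCalc hA v))
    (((hp.tendsto_funCalc hA w).inner (hq.tendsto_funCalc hA v)).congr fun n => ?_)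
  rw [inner_polyOp_left hA.isSymmetric, map_mul, mul_apply_eq_comp]

lemma norm_funCalc_sq (hA : A.IsPositive) (hh : Admissible A h) (v : H) :
    ‖funCalc A h v‖ ^ 2 = ∫ t, h t ^ 2 ∂(spectralMeasure A v) := by
  obtain ⟨p, hp⟩ := hh
  have tendsto_integral := (hp.mul hp).tendsto_integral hA v
  simp only [← sq, Polynomial.eval_pow, ← norm_polyOp_sq hA] at tendsto_integral
  exact tendsto_nhds_unique ((hp.tendsto_funCalc hA v).norm.pow 2) tendsto_integral

end FunctionalCalculus

section Injective

variable {𝕜 H : Type*} [RCLike 𝕜] [NormedAddCommGroup H] [InnerProductSpace 𝕜 H]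
  {A : H →L[𝕜] H} {h k : ℝ → ℝ}

/-- `1_{0}` is the limit of `(1 - t / (‖A‖ + 1)) ^ n` on `[0, ‖A‖]`. -/
lemma admissible_indicator_singleton_zero (hA : A.IsPositive) :
    Admissible A (({0} : Set ℝ).indicator 1) := by
  have pos : 0 < (‖A‖ + 1)⁻¹ := by positivity
  have base_mem (t : ℝ) (ht : t ∈ Icc 0 ‖A‖) : 1 - (‖A‖ + 1)⁻¹ * t ∈ Icc (0 : ℝ) 1 := by
    have le_one : (‖A‖ + 1)⁻¹ * t ≤ 1 := by
      rw [inv_mul_le_iff₀ (by positivity)]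
      linarith [ht.2]
    exact ⟨sub_nonneg.2 le_one, sub_le_self _ (mul_nonneg pos.le ht.1)⟩
  refine ⟨fun n => (1 - Polynomial.C (‖A‖ + 1)⁻¹ * Polynomial.X) ^ n, ⟨1, fun n t ht => ?_⟩,
    fun v => ?_⟩
  · simp only [Polynomial.eval_pow, Polynomial.eval_sub, Polynomial.eval_one, Polynomial.eval_mul,
      Polynomial.eval_C, Polynomial.eval_X]
    rw [abs_of_nonneg (pow_nonneg (base_mem t ht).1 n)]
    exact pow_le_one₀ (base_mem t ht).1 (base_mem t ht).2
  · filter_upwards [ae_mem_Icc_spectralMeasure hA v] with t ht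
    simp only [Polynomial.eval_pow, Polynomial.eval_sub, Polynomial.eval_one, Polynomial.eval_mul,
      Polynomial.eval_C, Polynomial.eval_X]
    rcases ht.1.eq_or_lt with rfl | t_pos
    · simp
    · rw [indicator_of_notMem (by simpa using t_pos.ne')]
      exact tendsto_pow_atTop_nhds_zero_of_lt_one (base_mem t ht).1
        (sub_lt_self _ (mul_pos pos t_pos))

variable [CompleteSpace H]

lemma spectralMeasure_singleton_zero (hA : A.IsPositive) (hinj : Function.Injective A) (v : H) :
    spectralMeasure A v {0} = 0 := by
  let e : ℝ → ℝ := ({0} : Set ℝ).indicator 1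
  have he : Admissible A e := admissible_indicator_singleton_zero hA
  have id_mul_e : (fun t => t * e t) = fun _ => 0 := by
    ext t
    by_cases ht : t = 0 <;> simp [e, ht]
  have e_sq : (fun t => e t ^ 2) = e := by
    ext t
    by_cases ht : t = 0 <;> simp [e, ht]
  have range_le_ker : A (funCalc A e v) = 0 := by
    have apply_mul := funCalc_mul hA (.id A) he v
    rwa [id_mul_e, funCalc_id hA, funCalc_zero hA, zero_apply, eq_comm] at apply_mul
  have mass := norm_funCalc_sq hA he v
  rw [hinj (range_le_ker.trans (map_zero A).symm), e_sq,
    integral_indicator_one (measurableSet_singleton _), norm_zero, zero_pow two_ne_zero] at mass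
  have := isFiniteMeasure_spectralMeasure hA v
  exact (measureReal_eq_zero_iff).1 mass.symm

lemma ae_mem_Ioc_spectralMeasure (hA : A.IsPositive) (hinj : Function.Injective A) (v : H) :
    ∀ᵐ t ∂(spectralMeasure A v), t ∈ Ioc 0 ‖A‖ := by
  have ne_zero : ∀ᵐ t ∂(spectralMeasure A v), t ≠ 0 :=
    ae_iff.2 (by simpa using spectralMeasure_singleton_zero hA hinj v)
  filter_upwards [ae_mem_Icc_spectralMeasure hA v, ne_zero] with t ht ht0
  exact ⟨lt_of_le_of_ne ht.1 ht0.symm, ht.2⟩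

lemma exists_bound_Ioc_of_continuousOn (hc : ContinuousOn h (Ioi 0))
    (hb : ∃ r > 0, ∃ C, ∀ t ∈ Ioc 0 r, |h t| ≤ C) (R : ℝ) : ∃ C, ∀ t ∈ Ioc 0 R, |h t| ≤ C := by
  obtain ⟨r, hr, C, hC⟩ := hb
  obtain ⟨D, hD⟩ := (isCompact_Icc (a := r) (b := R)).exists_bound_of_continuousOn
    (hc.mono fun t ht => hr.trans_le ht.1)
  refine ⟨max C D, fun t ht => ?_⟩
  rcases le_total t r with htr | hrt
  · exact (hC t ⟨ht.1, htr⟩).trans (le_max_left _ _)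
  · exact (hD t ⟨hrt, ht.2⟩).trans (le_max_right _ _)

/-- Approximate `t ↦ h (max t (1 / (n + 1)))` by polynomials. -/
lemma admissible_of_continuousOn (hA : A.IsPositive) (hinj : Function.Injective A)
    (hc : ContinuousOn h (Ioi 0)) (hb : ∃ r > 0, ∃ C, ∀ t ∈ Ioc 0 r, |h t| ≤ C) :
    Admissible A h := by
  let ε (n : ℕ) : ℝ := 1 / (n + 1)
  have ε_pos (n : ℕ) : 0 < ε n := Nat.one_div_pos_of_nat
  have ε_le_one (n : ℕ) : ε n ≤ 1 := by
    rw [div_le_one (by positivity)]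
    linarith [n.cast_nonneg (α := ℝ)]
  have tendsto_ε : Tendsto ε atTop (𝓝 0) := tendsto_one_div_add_atTop_nhds_zero_nat
  have continuousOn_clamped (n : ℕ) : ContinuousOn (fun t => h (max t (ε n))) (Icc 0 ‖A‖) :=
    hc.comp (by fun_prop) fun t _ => (ε_pos n).trans_le (le_max_right _ _)
  choose p hp using fun n : ℕ =>
    exists_polynomial_near_of_continuousOn 0 ‖A‖ _ (continuousOn_clamped n) _ (ε_pos n)
  obtain ⟨C, hC⟩ := exists_bound_Ioc_of_continuousOn hc hb (max ‖A‖ 1)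
  refine ⟨p, ⟨1 + C, fun n t ht => ?_⟩, fun v => ?_⟩
  · have clamped_le : |h (max t (ε n))| ≤ C :=
      hC _ ⟨(ε_pos n).trans_le (le_max_right _ _), max_le_max ht.2 (ε_le_one n)⟩
    calc |(p n).eval t| = |((p n).eval t - h (max t (ε n))) + h (max t (ε n))| := by
          rw [sub_add_cancel]
      _ ≤ 1 + C := (abs_add_le _ _).trans
          (add_le_add ((hp n t ht).le.trans (ε_le_one n)) clamped_le)
  · filter_upwards [ae_mem_Ioc_spectralMeasure hA hinj v] with t ht
    rw [tendsto_iff_dist_tendsto_zero]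
    refine squeeze_zero' (.of_forall fun n => dist_nonneg) ?_ tendsto_ε
    filter_upwards [tendsto_ε.eventually_lt_const ht.1] with n hn
    have near := hp n t ⟨ht.1.le, ht.2⟩
    rw [max_eq_left hn.le] at near
    exact near.le

lemma IsIndexFunction.admissible (hA : A.IsPositive) (hinj : Function.Injective A) {φ : ℝ → ℝ}
    (hφ : IsIndexFunction φ) : Admissible A φ :=
  admissible_of_continuousOn hA hinj hφ.continuousOn ⟨1, one_pos, φ 1, fun t ht => by
    rw [abs_of_nonneg (hφ.nonneg t ht.1)]
    exact hφ.monotoneOn ht.1 (mem_Ioi.2 one_pos) ht.2⟩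

lemma norm_funCalc_mono (hA : A.IsPositive) (hinj : Function.Injective A) (hh : Admissible A h)
    (hk : Admissible A k) (hle : ∀ t > 0, |h t| ≤ |k t|) (v : H) :
    ‖funCalc A h v‖ ≤ ‖funCalc A k v‖ := by
  rw [← sq_le_sq₀ (norm_nonneg _) (norm_nonneg _), norm_funCalc_sq hA hh, norm_funCalc_sq hA hk]
  refine integral_mono_ae (hh.sq.integrable hA v) (hk.sq.integrable hA v) ?_
  filter_upwards [ae_mem_Ioc_spectralMeasure hA hinj v] with t ht using sq_le_sq.2 (hle t ht.1)

lemma norm_funCalc_le (hA : A.IsPositive) (hinj : Function.Injective A) (hh : Admissible A h)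
    {C : ℝ} (hC : ∀ t > 0, |h t| ≤ C) (v : H) : ‖funCalc A h v‖ ≤ C * ‖v‖ := by
  have C_nonneg : 0 ≤ C := (abs_nonneg _).trans (hC 1 one_pos)
  refine (norm_funCalc_mono hA hinj hh (.const A C) (fun t ht => (hC t ht).trans (le_abs_self C))
    v).trans_eq ?_
  rw [← sq_eq_sq₀ (norm_nonneg _) (by positivity), norm_funCalc_sq hA (.const A C), integral_const,
    spectralMeasure_real_univ hA, smul_eq_mul, mul_pow, mul_comm]

end Injective

section Adjoint

variable {𝕜 X Y : Type*} [RCLike 𝕜]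
  [NormedAddCommGroup X] [InnerProductSpace 𝕜 X] [CompleteSpace X]
  [NormedAddCommGroup Y] [InnerProductSpace 𝕜 Y] [CompleteSpace Y]

open ContinuousLinearMap (adjoint)

lemma isPositive_TstarT (T : X →L[𝕜] Y) : (TstarT T).IsPositive :=
  ContinuousLinearMap.isPositive_adjoint_comp_self T

lemma isPositive_TTstar (T : X →L[𝕜] Y) : (TTstar T).IsPositive :=
  ContinuousLinearMap.isPositive_self_comp_adjoint T

lemma injective_TstarT {T : X →L[𝕜] Y} (hT : Function.Injective T) :
    Function.Injective (TstarT T) := by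
  rw [injective_iff_map_eq_zero]
  intro x hx
  have inner_self_zero : ⟪T x, T x⟫_𝕜 = 0 := by
    rw [← ContinuousLinearMap.adjoint_inner_right, show adjoint T (T x) = 0 from hx,
      inner_zero_right]
  exact hT ((inner_self_eq_zero.1 inner_self_zero).trans (map_zero T).symm)

lemma norm_TTstar (T : X →L[𝕜] Y) : ‖TTstar T‖ = ‖TstarT T‖ := by
  have norm_mul_self := ContinuousLinearMap.norm_adjoint_comp_self (adjoint T)
  rw [ContinuousLinearMap.adjoint_adjoint, LinearIsometryEquiv.norm_map] at norm_mul_self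
  exact norm_mul_self.trans (ContinuousLinearMap.norm_adjoint_comp_self T).symm

lemma adjoint_TTstar_pow (T : X →L[𝕜] Y) (n : ℕ) (z : Y) :
    adjoint T ((TTstar T ^ n) z) = (TstarT T ^ n) (adjoint T z) := by
  induction n generalizing z with
  | zero => simp
  | succ n ih =>
    rw [pow_succ, mul_apply_eq_comp, ih, pow_succ, mul_apply_eq_comp]
    rfl

lemma spectralMeasure_adjoint (T : X →L[𝕜] Y) (z : Y) :
    spectralMeasure (TstarT T) (adjoint T z)
      = (spectralMeasure (TTstar T) z).withDensity ENNReal.ofReal := by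
  have hTT := isPositive_TTstar T
  refine IsSpectralMeasure.eq (isPositive_TstarT T) ⟨?_, ?_, fun n => ?_⟩
  · exact isFiniteMeasure_withDensity_ofReal
      (integrable_spectralMeasure_of_continuous hTT z continuous_id).2
  · rw [← norm_TTstar]
    exact withDensity_absolutelyContinuous _ _ (isSpectralMeasure_spectralMeasure hTT z).2.1
  · rw [integral_withDensity_eq_integral_toReal_smul (by fun_prop) (.of_forall fun t => by simp)]
    calc ∫ t, (ENNReal.ofReal t).toReal • t ^ n ∂(spectralMeasure (TTstar T) z)
        = ∫ t, t ^ (n + 1) ∂(spectralMeasure (TTstar T) z) := by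
          refine integral_congr_ae ?_
          filter_upwards [ae_mem_Icc_spectralMeasure hTT z] with t ht
          rw [ENNReal.toReal_ofReal ht.1, smul_eq_mul, pow_succ']
      _ = RCLike.re ⟪adjoint T z, (TstarT T ^ n) (adjoint T z)⟫_𝕜 := by
          rw [integral_pow_spectralMeasure hTT, ← adjoint_TTstar_pow,
            ContinuousLinearMap.adjoint_inner_left, pow_succ']
          rfl

lemma setIntegral_spectralMeasure_adjoint (T : X →L[𝕜] Y) (z : Y) (h : ℝ → ℝ) {s : Set ℝ}
    (hs : MeasurableSet s) :
    ∫ t in s, h t ∂(spectralMeasure (TstarT T) (adjoint T z))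
      = ∫ t in s, t * h t ∂(spectralMeasure (TTstar T) z) := by
  rw [spectralMeasure_adjoint, restrict_withDensity hs,
    integral_withDensity_eq_integral_toReal_smul (by fun_prop) (.of_forall fun t => by simp)]
  refine integral_congr_ae ?_
  filter_upwards [ae_restrict_of_ae (ae_mem_Icc_spectralMeasure (isPositive_TTstar T) z)] with t ht
  rw [ENNReal.toReal_ofReal ht.1, smul_eq_mul]

lemma norm_funCalc_adjoint_le {T : X →L[𝕜] Y} {h : ℝ → ℝ} (hh : Admissible (TstarT T) h) {C : ℝ}
    (hC : ∀ t ≥ 0, √t * |h t| ≤ C) (z : Y) : ‖funCalc (TstarT T) h (adjoint T z)‖ ≤ C * ‖z‖ := by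
  have C_nonneg : 0 ≤ C := by simpa using hC 0 le_rfl
  have hTT := isPositive_TTstar T
  have := isFiniteMeasure_spectralMeasure hTT z
  rw [← sq_le_sq₀ (norm_nonneg _) (by positivity), norm_funCalc_sq (isPositive_TstarT T) hh]
  calc ∫ t, h t ^ 2 ∂(spectralMeasure (TstarT T) (adjoint T z))
      = ∫ t, t * h t ^ 2 ∂(spectralMeasure (TTstar T) z) := by
        simpa using setIntegral_spectralMeasure_adjoint T z (fun t => h t ^ 2) MeasurableSet.univ
    _ ≤ ∫ _, C ^ 2 ∂(spectralMeasure (TTstar T) z) := by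
        have mem_Icc := ae_mem_Icc_spectralMeasure hTT z
        refine integral_mono_of_nonneg ?_ (integrable_const _) ?_
        · filter_upwards [mem_Icc] with t ht using mul_nonneg ht.1 (sq_nonneg _)
        · filter_upwards [mem_Icc] with t ht
          simpa only [mul_pow, Real.sq_sqrt ht.1, sq_abs] using
            pow_le_pow_left₀ (by positivity) (hC t ht.1) 2
    _ = (C * ‖z‖) ^ 2 := by
        rw [integral_const, spectralMeasure_real_univ hTT, smul_eq_mul, mul_pow, mul_comm]

end Adjoint

/-! ### The Muckenhoupt condition and lower bounds for functions of `A` -/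

section Muckenhoupt

variable {𝕜 H : Type*} [RCLike 𝕜] [NormedAddCommGroup H] [InnerProductSpace 𝕜 H]
  {A : H →L[𝕜] H} {h k κ ω : ℝ → ℝ} {c : ℝ} {v : H}

/-- The Muckenhoupt-type condition `α² ∫_{(α,∞)} t⁻² κ² d‖E_t v‖² ≤ c ∫_{(0,α]} κ² d‖E_t v‖²` for
the spectral family of `A`; the noise condition is the case `A = T*T`, `v = T*(y^δ - y)`. -/
def MuckenhouptAt (A : H →L[𝕜] H) (κ : ℝ → ℝ) (c : ℝ) (v : H) : Prop :=
  ∀ α > 0, α ^ 2 * ∫ t in Ioi α, (t⁻¹ * κ t) ^ 2 ∂(spectralMeasure A v)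
    ≤ c * ∫ t in Ioc 0 α, κ t ^ 2 ∂(spectralMeasure A v)

lemma setIntegral_sq_le_of_abs_le {μ : Measure ℝ} {s : Set ℝ} (hs : MeasurableSet s)
    (hh : IntegrableOn (fun t => h t ^ 2) s μ) (hk : IntegrableOn (fun t => k t ^ 2) s μ) {C : ℝ}
    (hle : ∀ t ∈ s, |h t| ≤ C * |k t|) : ∫ t in s, h t ^ 2 ∂μ ≤ C ^ 2 * ∫ t in s, k t ^ 2 ∂μ := by
  rw [← integral_const_mul]
  refine setIntegral_mono_on hh (hk.const_mul _) hs fun t ht => ?_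
  simpa only [mul_pow, sq_abs] using pow_le_pow_left₀ (abs_nonneg _) (hle t ht) 2

variable [CompleteSpace H]

lemma integrableOn_inv_mul_sq (hA : A.IsPositive) (hinj : Function.Injective A)
    (hκ : Admissible A κ) {α : ℝ} (hα : 0 < α) (v : H) :
    IntegrableOn (fun t => (t⁻¹ * κ t) ^ 2) (Ioi α) (spectralMeasure A v) := by
  have clamped_pos (t : ℝ) : 0 < max t α := hα.trans_le (le_max_right t α)
  have admissible_inv : Admissible A fun t => (max t α)⁻¹ := by
    refine admissible_of_continuousOn hA hinj (Continuous.continuousOn ?_)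
      ⟨1, one_pos, α⁻¹, fun t _ => ?_⟩
    · exact (by fun_prop : Continuous fun t => max t α).inv₀ fun t => (clamped_pos t).ne'
    · rw [abs_of_pos (inv_pos.2 (clamped_pos t))]
      exact inv_anti₀ hα (le_max_right t α)
  refine ((admissible_inv.mul hκ).sq.integrable hA v).integrableOn.congr_fun (fun t ht => ?_)
    measurableSet_Ioi
  simp only [max_eq_left (mem_Ioi.1 ht).le]

lemma MuckenhouptAt.of_monotoneOn_div (hA : A.IsPositive) (hinj : Function.Injective A)
    (hM : MuckenhouptAt A κ c v) (hc : 0 ≤ c) (hκ : Admissible A κ) (hω : Admissible A ω)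
    (hκ0 : ∀ t > 0, 0 < κ t) (hω0 : ∀ t > 0, 0 < ω t)
    (hmono : MonotoneOn (fun t => κ t / ω t) (Ioi 0)) : MuckenhouptAt A ω c v := by
  intro α hα
  set b := κ α / ω α
  have b_pos : 0 < b := div_pos (hκ0 α hα) (hω0 α hα)
  have near : ∫ t in Ioc 0 α, κ t ^ 2 ∂(spectralMeasure A v)
      ≤ b ^ 2 * ∫ t in Ioc 0 α, ω t ^ 2 ∂(spectralMeasure A v) :=
    setIntegral_sq_le_of_abs_le measurableSet_Ioc (hκ.sq.integrable hA v).integrableOn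
      (hω.sq.integrable hA v).integrableOn fun t ht => by
        rw [abs_of_pos (hκ0 t ht.1), abs_of_pos (hω0 t ht.1), ← div_le_iff₀ (hω0 t ht.1)]
        exact hmono ht.1 hα ht.2
  have far : ∫ t in Ioi α, (t⁻¹ * ω t) ^ 2 ∂(spectralMeasure A v)
      ≤ b⁻¹ ^ 2 * ∫ t in Ioi α, (t⁻¹ * κ t) ^ 2 ∂(spectralMeasure A v) :=
    setIntegral_sq_le_of_abs_le measurableSet_Ioi (integrableOn_inv_mul_sq hA hinj hω hα v)
      (integrableOn_inv_mul_sq hA hinj hκ hα v) fun t ht => by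
        have t_pos : 0 < t := hα.trans ht
        rw [abs_mul, abs_mul, abs_of_pos (hκ0 t t_pos), abs_of_pos (hω0 t t_pos), mul_left_comm]
        refine mul_le_mul_of_nonneg_left ?_ (abs_nonneg _)
        rw [le_inv_mul_iff₀ b_pos, ← le_div_iff₀ (hω0 t t_pos)]
        exact hmono hα t_pos (mem_Ioi.1 ht).le
  calc α ^ 2 * ∫ t in Ioi α, (t⁻¹ * ω t) ^ 2 ∂(spectralMeasure A v)
      ≤ α ^ 2 * (b⁻¹ ^ 2 * ∫ t in Ioi α, (t⁻¹ * κ t) ^ 2 ∂(spectralMeasure A v)) := by gcongr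
    _ = b⁻¹ ^ 2 * (α ^ 2 * ∫ t in Ioi α, (t⁻¹ * κ t) ^ 2 ∂(spectralMeasure A v)) := by ring
    _ ≤ b⁻¹ ^ 2 * (c * (b ^ 2 * ∫ t in Ioc 0 α, ω t ^ 2 ∂(spectralMeasure A v))) :=
        mul_le_mul_of_nonneg_left ((hM α hα).trans (mul_le_mul_of_nonneg_left near hc))
          (sq_nonneg _)
    _ = c * ∫ t in Ioc 0 α, ω t ^ 2 ∂(spectralMeasure A v) := by field_simp

lemma MuckenhouptAt.norm_funCalc_le (hA : A.IsPositive) (hinj : Function.Injective A)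
    (hM : MuckenhouptAt A κ c v) (hc : 0 ≤ c) (hκ : Admissible A κ) (hh : Admissible A h)
    (hk : Admissible A k) {α C D : ℝ} (hα : 0 < α) (hD : 0 ≤ D)
    (near : ∀ t ∈ Ioc 0 α, |h t| ≤ C / α * |κ t|) (far : ∀ t > α, |h t| ≤ |t⁻¹ * κ t|)
    (lower : ∀ t ∈ Ioc 0 α, |κ t| ≤ D * α * |k t|) :
    ‖funCalc A h v‖ ≤ √(C ^ 2 + c) * D * ‖funCalc A k v‖ := by
  have integrable_h := hh.sq.integrable hA v
  have integrable_k := hk.sq.integrable hA v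
  have integrable_κ := hκ.sq.integrable hA v
  rw [← sq_le_sq₀ (norm_nonneg _) (by positivity), norm_funCalc_sq hA hh, mul_pow, mul_pow,
    Real.sq_sqrt (by positivity), norm_funCalc_sq hA hk]
  have ae_pos : ∀ᵐ t ∂(spectralMeasure A v), t ∈ Ioi 0 :=
    (ae_mem_Ioc_spectralMeasure hA hinj v).mono fun t ht => ht.1
  have muckenhoupt := hM α hα
  set μ := spectralMeasure A v
  have near_le := setIntegral_sq_le_of_abs_le measurableSet_Ioc integrable_h.integrableOn
    integrable_κ.integrableOn near
  have far_le : ∫ t in Ioi α, h t ^ 2 ∂μ ≤ 1 ^ 2 * ∫ t in Ioi α, (t⁻¹ * κ t) ^ 2 ∂μ :=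
    setIntegral_sq_le_of_abs_le measurableSet_Ioi integrable_h.integrableOn
      (integrableOn_inv_mul_sq hA hinj hκ hα v) fun t ht => by simpa only [one_mul] using far t ht
  have lower_le := setIntegral_sq_le_of_abs_le measurableSet_Ioc integrable_κ.integrableOn
    integrable_k.integrableOn lower
  have lower_le_integral : ∫ t in Ioc 0 α, k t ^ 2 ∂μ ≤ ∫ t, k t ^ 2 ∂μ :=
    setIntegral_le_integral integrable_k (.of_forall fun t => sq_nonneg _)
  calc ∫ t, h t ^ 2 ∂μ = ∫ t in Ioc 0 α, h t ^ 2 ∂μ + ∫ t in Ioi α, h t ^ 2 ∂μ := by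
        rw [← setIntegral_union (Set.Ioc_disjoint_Ioi le_rfl) measurableSet_Ioi
          integrable_h.integrableOn integrable_h.integrableOn, Ioc_union_Ioi_eq_Ioi hα.le,
          Measure.restrict_eq_self_of_ae_mem ae_pos]
    _ ≤ (C / α) ^ 2 * ∫ t in Ioc 0 α, κ t ^ 2 ∂μ + c / α ^ 2 * ∫ t in Ioc 0 α, κ t ^ 2 ∂μ := by
        refine add_le_add near_le (far_le.trans ?_)
        rwa [one_pow, one_mul, div_mul_eq_mul_div, le_div_iff₀ (by positivity), mul_comm]
    _ = (C ^ 2 + c) / α ^ 2 * ∫ t in Ioc 0 α, κ t ^ 2 ∂μ := by ring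
    _ ≤ (C ^ 2 + c) / α ^ 2 * ((D * α) ^ 2 * ∫ t, k t ^ 2 ∂μ) := by
        gcongr
        exact lower_le.trans (by gcongr)
    _ = (C ^ 2 + c) * D ^ 2 * ∫ t, k t ^ 2 ∂μ := by field_simp

end Muckenhoupt

section LowerBound

variable {𝕜 H : Type*} [RCLike 𝕜] [NormedAddCommGroup H] [InnerProductSpace 𝕜 H]
  [CompleteSpace H] {A : H →L[𝕜] H} {m : ℝ → ℝ}

lemma integrable_sq_min_one (hA : A.IsPositive) (hinj : Function.Injective A)
    (hm : Measurable fun t : Ioi (0 : ℝ) => m t) (hm0 : ∀ t > 0, 0 < m t) (v : H) :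
    Integrable (fun t => min (m t) 1 ^ 2) (spectralMeasure A v) := by
  have := isFiniteMeasure_spectralMeasure hA v
  have ae_pos : ∀ᵐ t ∂(spectralMeasure A v), t ∈ Ioi 0 :=
    (ae_mem_Ioc_spectralMeasure hA hinj v).mono fun t ht => ht.1
  have aemeasurable_m : AEMeasurable m (spectralMeasure A v) := by
    rw [← Measure.restrict_eq_self_of_ae_mem ae_pos]
    exact aemeasurable_restrict_of_measurable_subtype measurableSet_Ioi hm
  refine Integrable.of_bound (C := 1)
    ((aemeasurable_m.min aemeasurable_const).pow_const 2).aestronglyMeasurable ?_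
  filter_upwards [ae_pos] with t ht
  rw [Real.norm_of_nonneg (sq_nonneg _)]
  exact pow_le_one₀ (le_min (hm0 t ht).le zero_le_one) (min_le_right _ _)

lemma integral_sq_min_one_pos (hA : A.IsPositive) (hinj : Function.Injective A)
    (hm : Measurable fun t : Ioi (0 : ℝ) => m t) (hm0 : ∀ t > 0, 0 < m t) {v : H} (hv : v ≠ 0) :
    0 < ∫ t, min (m t) 1 ^ 2 ∂(spectralMeasure A v) := by
  have nonzero : spectralMeasure A v ≠ 0 := fun measure_zero => hv <| by
    have mass := spectralMeasure_real_univ hA v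
    rwa [measure_zero, measureReal_zero_apply, eq_comm, sq_eq_zero_iff, norm_eq_zero] at mass
  rw [integral_pos_iff_support_of_nonneg_ae (.of_forall fun t => sq_nonneg _)
    (integrable_sq_min_one hA hinj hm hm0 v), pos_iff_ne_zero]
  have support_ae : ∀ᵐ t ∂(spectralMeasure A v),
      t ∈ Function.support fun t => min (m t) 1 ^ 2 := by
    filter_upwards [ae_mem_Ioc_spectralMeasure hA hinj v] with t ht
    exact (pow_pos (lt_min (hm0 t ht.1) one_pos) 2).ne'
  exact (measure_congr (eventuallyEq_univ.2 support_ae)).trans_ne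
    (Measure.measure_univ_ne_zero.2 nonzero)

lemma integral_sq_min_one_le (hA : A.IsPositive) (hinj : Function.Injective A)
    (hm : Measurable fun t : Ioi (0 : ℝ) => m t) (hm0 : ∀ t > 0, 0 < m t) (u v : H) :
    ∫ t, min (m t) 1 ^ 2 ∂(spectralMeasure A v)
      ≤ 2 * (∫ t, min (m t) 1 ^ 2 ∂(spectralMeasure A u) + ‖u - v‖ ^ 2) := by
  let q : ℝ → ℝ := fun t => min (m t) 1 ^ 2
  have integrable_q := integrable_sq_min_one hA hinj hm hm0
  have := isFiniteMeasure_spectralMeasure hA (v - u)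
  have noise_le : ∫ t, q t ∂(spectralMeasure A (v - u)) ≤ ‖u - v‖ ^ 2 := by
    rw [norm_sub_rev, ← spectralMeasure_real_univ hA, ← mul_one (Measure.real _ _), ← smul_eq_mul,
      ← integral_const]
    refine integral_mono_ae (integrable_q _) (integrable_const _) ?_
    filter_upwards [ae_mem_Ioc_spectralMeasure hA hinj (v - u)] with t ht
    exact pow_le_one₀ (le_min (hm0 t ht.1).le zero_le_one) (min_le_right _ _)
  have parallelogram := spectralMeasure_parallelogram hA u (v - u)
  rw [add_sub_cancel] at parallelogram
  calc ∫ t, q t ∂(spectralMeasure A v)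
      ≤ ∫ t, q t ∂(spectralMeasure A v + spectralMeasure A (u - (v - u))) :=
        integral_mono_measure (Measure.le_add_right le_rfl) (.of_forall fun t => sq_nonneg _)
          ((integrable_q _).add_measure (integrable_q _))
    _ = 2 * (∫ t, q t ∂(spectralMeasure A u) + ∫ t, q t ∂(spectralMeasure A (v - u))) := by
        rw [parallelogram, integral_smul_nnreal_measure,
          integral_add_measure (integrable_q _) (integrable_q _)]
        rfl
    _ ≤ 2 * (∫ t, q t ∂(spectralMeasure A u) + ‖u - v‖ ^ 2) := by gcongr

lemma exists_eventually_le_norm_funCalc (hA : A.IsPositive) (hinj : Function.Injective A)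
    (hm : Measurable fun t : Ioi (0 : ℝ) => m t) (hm0 : ∀ t > 0, 0 < m t) {v : H} (hv : v ≠ 0) :
    ∃ c > 0, ∀ᶠ u in 𝓝 v, ∀ h, Admissible A h → ∀ α ≥ 0, (∀ t > 0, m t * α ≤ |h t|) →
      c * α ≤ ‖funCalc A h u‖ := by
  set I := ∫ t, min (m t) 1 ^ 2 ∂(spectralMeasure A v)
  have I_pos : 0 < I := integral_sq_min_one_pos hA hinj hm hm0 hv
  refine ⟨√(I / 4), by positivity, ?_⟩
  have tendsto_dist : Tendsto (fun u => ‖u - v‖ ^ 2) (𝓝 v) (𝓝 0) := by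
    simpa using (by fun_prop : Continuous fun u => ‖u - v‖ ^ 2).tendsto v
  filter_upwards [tendsto_dist.eventually_lt_const (div_pos I_pos four_pos)] with u hu h hh α hα hle
  have mass_le : I / 4 ≤ ∫ t, min (m t) 1 ^ 2 ∂(spectralMeasure A u) := by
    linarith [integral_sq_min_one_le hA hinj hm hm0 u v]
  rw [← sq_le_sq₀ (by positivity) (norm_nonneg _), norm_funCalc_sq hA hh, mul_pow,
    Real.sq_sqrt (by positivity)]
  calc I / 4 * α ^ 2 ≤ (∫ t, min (m t) 1 ^ 2 ∂(spectralMeasure A u)) * α ^ 2 := by gcongr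
    _ = ∫ t, (min (m t) 1 * α) ^ 2 ∂(spectralMeasure A u) := by
        simp only [mul_pow, integral_mul_const]
    _ ≤ ∫ t, h t ^ 2 ∂(spectralMeasure A u) := by
        refine integral_mono_of_nonneg (.of_forall fun t => sq_nonneg _)
          (hh.sq.integrable hA u) ?_
        filter_upwards [ae_mem_Ioc_spectralMeasure hA hinj u] with t ht
        have min_nonneg : 0 ≤ min (m t) 1 := le_min (hm0 t ht.1).le zero_le_one
        rw [← sq_abs (h t)]
        refine pow_le_pow_left₀ (mul_nonneg min_nonneg hα) ?_ 2
        exact (mul_le_mul_of_nonneg_right (min_le_left _ _) hα).trans (hle t ht.1)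

end LowerBound

/-! ### Filter functions and the quasi-optimality functional -/

section Filters

variable {𝕜 X Y : Type*} [RCLike 𝕜]
  [NormedAddCommGroup X] [InnerProductSpace 𝕜 X] [NormedAddCommGroup Y] [InnerProductSpace 𝕜 Y]
  {T : X →L[𝕜] Y} {g : ℝ → ℝ → ℝ} {φ κ : ℝ → ℝ} {α t : ℝ}

lemma isIndexFunction_one : IsIndexFunction 1 where
  continuousOn := continuousOn_const
  nonneg _ _ := zero_le_one
  monotoneOn := monotoneOn_const

/-- The filter function `(1 - t g_α(t)) g_α(t)` of the quasi-optimality functional. -/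
def qoFilter (g : ℝ → ℝ → ℝ) (α t : ℝ) : ℝ := (1 - t * g α t) * g α t

lemma continuousOn_qoFilter (hg : ContinuousOn (g α) (Ioi 0)) :
    ContinuousOn (qoFilter g α) (Ioi 0) :=
  (continuousOn_const.sub (continuousOn_id.mul hg)).mul hg

namespace StructuralAssumption

lemma filter_nonneg (hS : StructuralAssumption T g φ κ) (hα : 0 < α) (ht : 0 < t) : 0 ≤ g α t :=
  nonneg_of_mul_nonneg_right (hS.filter_range α hα t ht).1 ht

lemma filter_le_inv (hS : StructuralAssumption T g φ κ) (hα : 0 < α) (ht : 0 < t) :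
    g α t ≤ t⁻¹ := by
  rw [← one_div, le_div_iff₀' ht]
  exact (hS.filter_range α hα t ht).2

lemma qoFilter_nonneg (hS : StructuralAssumption T g φ κ) (hα : 0 < α) (ht : 0 < t) :
    0 ≤ qoFilter g α t :=
  mul_nonneg (sub_nonneg.2 (hS.filter_range α hα t ht).2) (hS.filter_nonneg hα ht)

lemma qoFilter_le_filter (hS : StructuralAssumption T g φ κ) (hα : 0 < α) (ht : 0 < t) :
    qoFilter g α t ≤ g α t :=
  mul_le_of_le_one_left (hS.filter_nonneg hα ht) (sub_le_self _ (hS.filter_range α hα t ht).1)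

lemma exists_filter_le (hS : StructuralAssumption T g φ κ) :
    ∃ C > 0, ∀ α > 0, ∀ t > 0, g α t ≤ C / α := by
  obtain ⟨_, _, c₄, _, two_sided⟩ := hS.filter_two_sided
  refine ⟨max c₄ 1, by positivity, fun α hα t ht => ?_⟩
  rcases lt_or_ge t α with htα | hαt
  · exact (two_sided α hα t ⟨ht, htα⟩).2.trans (by gcongr; exact le_max_left _ _)
  · refine (hS.filter_le_inv hα ht).trans ?_
    rw [← one_div]
    gcongr
    exact le_max_right _ _

/-- The structural conditions give the bound on `(0, α)`; continuity extends it to `t = α`. -/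
lemma exists_le_qoFilter (hS : StructuralAssumption T g φ κ)
    (hg : ∀ α > 0, ContinuousOn (g α) (Ioi 0)) :
    ∃ c > 0, ∀ α > 0, ∀ t ∈ Ioc 0 α, c / α ≤ qoFilter g α t := by
  obtain ⟨c₂, hc₂, residual_lower⟩ := hS.residual_lower
  obtain ⟨c₃, hc₃, _, _, two_sided⟩ := hS.filter_two_sided
  refine ⟨c₂ * c₃, by positivity, fun α hα t ht => ?_⟩
  have interior : ∀ s ∈ Ioo 0 α, c₂ * c₃ / α ≤ qoFilter g α s := fun s hs => by
    rw [mul_div_assoc]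
    exact mul_le_mul (residual_lower α hα s hs) (two_sided α hα s hs).1 (by positivity)
      (hc₂.le.trans (residual_lower α hα s hs))
  rcases ht.2.lt_or_eq with htα | rfl
  · exact interior t ⟨ht.1, htα⟩
  · have continuousAt : ContinuousAt (qoFilter g t) t :=
      (continuousOn_qoFilter (hg t ht.1)).continuousAt (Ioi_mem_nhds ht.1)
    refine ge_of_tendsto (continuousAt.tendsto.mono_left (nhdsWithin_le_nhds (s := Iio t))) ?_
    filter_upwards [Ioo_mem_nhdsLT ht.1] with s hs using interior s hs

lemma bddBelow_qoFilter_div (hS : StructuralAssumption T g φ κ) (ht : 0 < t) :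
    BddBelow (range fun α : Ioc (0 : ℝ) ‖T‖ => qoFilter g α t / α) := by
  refine ⟨0, ?_⟩
  rintro _ ⟨α, rfl⟩
  exact div_nonneg (hS.qoFilter_nonneg α.2.1 ht) α.2.1.le

lemma iInf_qoFilter_mul_le (hS : StructuralAssumption T g φ κ) (ht : 0 < t)
    (hα : α ∈ Ioc 0 ‖T‖) :
    (⨅ β : Ioc (0 : ℝ) ‖T‖, qoFilter g β t / β) * α ≤ qoFilter g α t := by
  rw [← le_div_iff₀ hα.1]
  exact ciInf_le (hS.bddBelow_qoFilter_div ht) (⟨α, hα⟩ : Ioc (0 : ℝ) ‖T‖)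

/-- An infimum of continuous functions is upper semicontinuous. -/
lemma measurable_iInf_qoFilter (hS : StructuralAssumption T g φ κ)
    (hg : ∀ α > 0, ContinuousOn (g α) (Ioi 0)) :
    Measurable fun t : Ioi (0 : ℝ) => ⨅ α : Ioc (0 : ℝ) ‖T‖, qoFilter g α t / α := by
  refine (upperSemicontinuous_ciInf (fun t => hS.bddBelow_qoFilter_div t.2) fun α => ?_).measurable
  exact ((continuousOn_qoFilter (hg α α.2.1)).domRestrict.div_const α).upperSemicontinuous

lemma kappa_pos (hS : StructuralAssumption T g φ κ) (hκ : IsIndexFunction κ)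
    (hκ0 : ∃ t > 0, κ t ≠ 0) (ht : 0 < t) : 0 < κ t := by
  obtain ⟨s, hs, hκs⟩ := hκ0
  obtain ⟨c, _, covered⟩ := hS.kappa_covered
  have κs_pos : 0 < κ s := (hκ.nonneg s hs).lt_of_ne' hκs
  refine (hκ.nonneg t ht).lt_of_ne fun κt_zero => ?_
  have t_lt_s : t < s := by
    by_contra! hle
    exact (κs_pos.trans_le (hκ.monotoneOn hs ht hle)).ne κt_zero
  have covered_at := covered t ht s t_lt_s
  rw [← κt_zero, zero_div, mul_zero] at covered_at
  exact covered_at.not_gt (div_pos κs_pos (Real.sqrt_pos.2 hs))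

/-- A zero of `φ` at `t` would make the residual vanish for small `α`, which contradicts the lower
bound on `qoFilter`. -/
lemma phi_pos (hS : StructuralAssumption T g φ κ) (hφ : IsIndexFunction φ) (hT : 0 < ‖T‖)
    (hφ0 : ∃ t > 0, φ t ≠ 0) (ht : 0 < t) : 0 < φ t := by
  obtain ⟨s, hs, hφs⟩ := hφ0
  obtain ⟨c, _, qualification⟩ := hS.qualification
  refine (hφ.nonneg t ht).lt_of_ne fun φt_zero => ?_
  have α_mem : min t ‖T‖ ∈ Ioc 0 ‖T‖ := ⟨lt_min ht hT, min_le_right _ _⟩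
  set α := min t ‖T‖
  have φα_zero : φ α = 0 := le_antisymm
    ((hφ.monotoneOn α_mem.1 ht (min_le_left _ _)).trans φt_zero.ge) (hφ.nonneg _ α_mem.1)
  have residual_zero := qualification α α_mem.1 s hs
  rw [φα_zero, mul_zero, abs_nonpos_iff, mul_eq_zero, or_iff_right hφs] at residual_zero
  have lower := hS.iInf_qoFilter_mul_le hs α_mem
  rw [qoFilter, residual_zero, zero_mul] at lower
  exact lower.not_gt (mul_pos (hS.lower_qualification s hs) α_mem.1)

lemma one (hS : StructuralAssumption T g φ κ) (hφ : IsIndexFunction φ) :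
    StructuralAssumption T g φ 1 where
  filter_range := hS.filter_range
  filter_sqrt := hS.filter_sqrt
  residual_lower := hS.residual_lower
  filter_two_sided := hS.filter_two_sided
  lower_qualification := hS.lower_qualification
  qualification := hS.qualification
  qualification_kappa := by simpa only [Pi.one_apply, one_mul] using hS.qualification
  kappa_covered := ⟨1, one_pos, fun α hα t ht => by
    rw [one_mul]
    exact one_div_le_one_div_of_le (Real.sqrt_pos.2 hα) (Real.sqrt_le_sqrt ht.le)⟩
  regular_variation c₈ hc₈ := by
    obtain ⟨c₉, hc₉, δ₀, hδ₀, variation⟩ := hS.regular_variation c₈ hc₈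
    refine ⟨max c₉ 1, by positivity, δ₀, hδ₀, fun δ hδ => ⟨?_, by simp⟩⟩
    exact (variation δ hδ).1.trans
      (mul_le_mul_of_nonneg_right (le_max_left _ _) (hφ.nonneg δ hδ.1))

lemma exists_sqrt_mul_filter_le (hS : StructuralAssumption T g φ κ) (hκ : IsIndexFunction κ) :
    ∃ C > 0, ∀ α > 0, ∀ t > 0, √t * (κ t * g α t) ≤ C * (κ α / √α) := by
  obtain ⟨c₁, hc₁, filter_sqrt⟩ := hS.filter_sqrt
  obtain ⟨c₇, _, covered⟩ := hS.kappa_covered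
  refine ⟨max c₁ c₇, by positivity, fun α hα t ht => ?_⟩
  have sqrt_pos : 0 < √t := Real.sqrt_pos.2 ht
  have κα_nonneg : 0 ≤ κ α := hκ.nonneg α hα
  rcases le_or_gt t α with htα | hαt
  · calc √t * (κ t * g α t) = κ t * (√t * g α t) := by ring
      _ ≤ κ α * (c₁ / √α) := mul_le_mul (hκ.monotoneOn ht hα htα) (filter_sqrt α hα t ht)
          (mul_nonneg sqrt_pos.le (hS.filter_nonneg hα ht)) κα_nonneg
      _ = c₁ * (κ α / √α) := by ring
      _ ≤ max c₁ c₇ * (κ α / √α) := by gcongr; exact le_max_left _ _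
  · calc √t * (κ t * g α t) = κ t / √t * (t * g α t) := by
          nth_rw 1 [← Real.div_sqrt (x := t)]
          ring
      _ ≤ κ t / √t := mul_le_of_le_one_right (div_nonneg (hκ.nonneg t ht) sqrt_pos.le)
          (hS.filter_range α hα t ht).2
      _ ≤ c₇ * (κ α / √α) := covered α hα t hαt
      _ ≤ max c₁ c₇ * (κ α / √α) := by gcongr; exact le_max_right _ _

end StructuralAssumption

end Filters

section QuasiOptimality

variable {𝕜 X Y : Type*} [RCLike 𝕜]
  [NormedAddCommGroup X] [InnerProductSpace 𝕜 X] [CompleteSpace X]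
  [NormedAddCommGroup Y] [InnerProductSpace 𝕜 Y] [CompleteSpace Y]
  {T : X →L[𝕜] Y} {g : ℝ → ℝ → ℝ} {φ κ ω : ℝ → ℝ} {α : ℝ}

open ContinuousLinearMap (adjoint)

lemma psi_eq_psiKappa_one (T : X →L[𝕜] Y) (g : ℝ → ℝ → ℝ) (α : ℝ) (z : Y) :
    psi T g α z = psiKappa T g 1 α z := by
  rw [psiKappa, funCalc_one (isPositive_TstarT T)]
  rfl

lemma qoResidual_sub (T : X →L[𝕜] Y) (g : ℝ → ℝ → ℝ) (α : ℝ) (z w : Y) :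
    qoResidual T g α (z - w) = qoResidual T g α z - qoResidual T g α w := by
  simp only [qoResidual, regSol, map_sub]
  abel

lemma psiKappa_sub_le (T : X →L[𝕜] Y) (g : ℝ → ℝ → ℝ) (ω : ℝ → ℝ) (α : ℝ) (z w : Y) :
    psiKappa T g ω α (z - w) ≤ psiKappa T g ω α z + psiKappa T g ω α w := by
  simp only [psiKappa, qoResidual_sub, map_sub]
  exact norm_sub_le _ _

lemma psiKappa_le_sub_add (T : X →L[𝕜] Y) (g : ℝ → ℝ → ℝ) (ω : ℝ → ℝ) (α : ℝ) (z w : Y) :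
    psiKappa T g ω α z ≤ psiKappa T g ω α (z - w) + psiKappa T g ω α w := by
  simp only [psiKappa, qoResidual_sub, map_sub]
  exact norm_le_norm_sub_add _ _

lemma NoiseCondition.exists_muckenhouptAt {y : Y} {yδ : ℝ → Y} (hN : NoiseCondition T κ y yδ) :
    ∃ c > 0, ∀ᶠ δ in 𝓝[>] (0 : ℝ), MuckenhouptAt (TstarT T) κ c (adjoint T (yδ δ - y)) := by
  obtain ⟨c, hc, δ₀, hδ₀, muckenhoupt⟩ := hN
  refine ⟨c, hc, ?_⟩
  filter_upwards [Ioo_mem_nhdsGT hδ₀] with δ hδ α hα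
  rw [setIntegral_spectralMeasure_adjoint _ _ _ measurableSet_Ioi,
    setIntegral_spectralMeasure_adjoint _ _ _ measurableSet_Ioc]
  convert muckenhoupt δ hδ α hα using 2
  refine setIntegral_congr_fun measurableSet_Ioi fun t ht => ?_
  have t_ne_zero : t ≠ 0 := (hα.trans ht).ne'
  field_simp

namespace StructuralAssumption

lemma admissible_filter (hS : StructuralAssumption T g φ κ) (hT : Function.Injective T)
    (hg : ∀ α > 0, ContinuousOn (g α) (Ioi 0)) (hα : 0 < α) : Admissible (TstarT T) (g α) := by
  obtain ⟨C, _, filter_le⟩ := hS.exists_filter_le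
  refine admissible_of_continuousOn (isPositive_TstarT T) (injective_TstarT hT) (hg α hα)
    ⟨1, one_pos, C / α, fun t ht => ?_⟩
  rw [abs_of_nonneg (hS.filter_nonneg hα ht.1)]
  exact filter_le α hα t ht.1

lemma admissible_residual (hS : StructuralAssumption T g φ κ) (hT : Function.Injective T)
    (hg : ∀ α > 0, ContinuousOn (g α) (Ioi 0)) (hα : 0 < α) :
    Admissible (TstarT T) fun t => 1 - t * g α t :=
  (Admissible.const _ 1).sub ((Admissible.id _).mul (hS.admissible_filter hT hg hα))

lemma admissible_qoFilter (hS : StructuralAssumption T g φ κ) (hT : Function.Injective T)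
    (hg : ∀ α > 0, ContinuousOn (g α) (Ioi 0)) (hα : 0 < α) :
    Admissible (TstarT T) (qoFilter g α) :=
  (hS.admissible_residual hT hg hα).mul (hS.admissible_filter hT hg hα)

lemma funCalc_residual (hS : StructuralAssumption T g φ κ) (hT : Function.Injective T)
    (hg : ∀ α > 0, ContinuousOn (g α) (Ioi 0)) (hα : 0 < α) (x : X) :
    funCalc (TstarT T) (fun t => 1 - t * g α t) x
      = x - TstarT T (funCalc (TstarT T) (g α) x) := by
  have hp := isPositive_TstarT T
  have admissible_g := hS.admissible_filter hT hg hα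
  rw [funCalc_sub hp (.const _ 1) ((Admissible.id _).mul admissible_g), ← Pi.one_def,
    funCalc_one hp, funCalc_mul hp (.id _) admissible_g, funCalc_id hp]
  rfl

lemma psiKappa_eq (hS : StructuralAssumption T g φ κ) (hT : Function.Injective T)
    (hg : ∀ α > 0, ContinuousOn (g α) (Ioi 0)) (hω : Admissible (TstarT T) ω) (hα : 0 < α)
    (z : Y) :
    psiKappa T g ω α z
      = ‖funCalc (TstarT T) (fun t => ω t * qoFilter g α t) (adjoint T z)‖ := by
  have hp := isPositive_TstarT T
  rw [funCalc_mul hp hω (hS.admissible_qoFilter hT hg hα)]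
  unfold qoFilter
  rw [funCalc_mul hp (hS.admissible_residual hT hg hα) (hS.admissible_filter hT hg hα),
    hS.funCalc_residual hT hg hα]
  rfl

lemma exists_psiKappa_exact_le (hS : StructuralAssumption T g φ κ) (hT : Function.Injective T)
    (hg : ∀ α > 0, ContinuousOn (g α) (Ioi 0)) (hφ : IsIndexFunction φ) (hκ : IsIndexFunction κ)
    (w : X) :
    ∃ C > 0, ∀ α > 0, psiKappa T g κ α (T (funCalc (TstarT T) φ w)) ≤ C * (κ α * φ α) := by
  obtain ⟨c, hc, qualification⟩ := hS.qualification_kappa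
  have hp := isPositive_TstarT T
  have hinj := injective_TstarT hT
  have admissible_κ := hκ.admissible hp hinj
  have admissible_tφ := (Admissible.id (TstarT T)).mul (hφ.admissible hp hinj)
  refine ⟨c * (‖w‖ + 1), by positivity, fun α hα => ?_⟩
  have admissible_κqo := admissible_κ.mul (hS.admissible_qoFilter hT hg hα)
  have κφ_nonneg : 0 ≤ κ α * φ α := mul_nonneg (hκ.nonneg α hα) (hφ.nonneg α hα)
  have adjoint_exact : adjoint T (T (funCalc (TstarT T) φ w))
      = funCalc (TstarT T) (fun t => t * φ t) w := by
    rw [funCalc_mul hp (.id _) (hφ.admissible hp hinj), funCalc_id hp]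
    rfl
  rw [hS.psiKappa_eq hT hg admissible_κ hα, adjoint_exact,
    ← funCalc_mul hp admissible_κqo admissible_tφ]
  calc _ ≤ c * (κ α * φ α) * ‖w‖ := by
        refine norm_funCalc_le hp hinj (admissible_κqo.mul admissible_tφ) (fun t ht => ?_) w
        have range := hS.filter_range α hα t ht
        rw [show κ t * qoFilter g α t * (t * φ t)
            = κ t * φ t * (1 - t * g α t) * (t * g α t) by rw [qoFilter]; ring,
          abs_mul, abs_of_nonneg range.1]
        exact (mul_le_of_le_one_right (abs_nonneg _) range.2).trans (qualification α hα t ht)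
    _ ≤ c * (κ α * φ α) * (‖w‖ + 1) := by gcongr; exact le_add_of_nonneg_right zero_le_one
    _ = c * (‖w‖ + 1) * (κ α * φ α) := by ring

lemma exists_psiKappa_le (hS : StructuralAssumption T g φ κ) (hT : Function.Injective T)
    (hg : ∀ α > 0, ContinuousOn (g α) (Ioi 0)) (hκ : IsIndexFunction κ) :
    ∃ C > 0, ∀ α > 0, ∀ z : Y, psiKappa T g κ α z ≤ C * (κ α / √α) * ‖z‖ := by
  obtain ⟨C, hC, sqrt_mul_le⟩ := hS.exists_sqrt_mul_filter_le hκ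
  have admissible_κ := hκ.admissible (isPositive_TstarT T) (injective_TstarT hT)
  refine ⟨C, hC, fun α hα z => ?_⟩
  rw [hS.psiKappa_eq hT hg admissible_κ hα]
  refine norm_funCalc_adjoint_le (admissible_κ.mul (hS.admissible_qoFilter hT hg hα))
    (fun t ht => ?_) z
  rcases ht.eq_or_lt with rfl | t_pos
  · rw [Real.sqrt_zero, zero_mul]
    exact mul_nonneg hC.le (div_nonneg (hκ.nonneg α hα) (Real.sqrt_nonneg _))
  · rw [abs_of_nonneg (mul_nonneg (hκ.nonneg t t_pos) (hS.qoFilter_nonneg hα t_pos))]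
    refine le_trans ?_ (sqrt_mul_le α hα t t_pos)
    gcongr
    exacts [hκ.nonneg t t_pos, hS.qoFilter_le_filter hα t_pos]

lemma exists_eventually_le_psiKappa (hS : StructuralAssumption T g φ κ)
    (hT : Function.Injective T) (hg : ∀ α > 0, ContinuousOn (g α) (Ioi 0))
    (hω : IsIndexFunction ω) (hω0 : ∀ t > 0, 0 < ω t) {y : Y} (hy : adjoint T y ≠ 0) :
    ∃ c > 0, ∀ᶠ z in 𝓝 y, ∀ α ∈ Ioc 0 ‖T‖, c * α ≤ psiKappa T g ω α z := by
  have hp := isPositive_TstarT T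
  have hinj := injective_TstarT hT
  have admissible_ω := hω.admissible hp hinj
  obtain ⟨c, hc, eventually_le⟩ := exists_eventually_le_norm_funCalc hp hinj
    (m := fun t => ω t * ⨅ α : Ioc (0 : ℝ) ‖T‖, qoFilter g α t / α)
    (hω.continuousOn.domRestrict.measurable.mul (hS.measurable_iInf_qoFilter hg))
    (fun t ht => mul_pos (hω0 t ht) (hS.lower_qualification t ht)) hy
  refine ⟨c, hc, ?_⟩
  filter_upwards [(adjoint T).continuous.tendsto y |>.eventually eventually_le] with z hz α hα
  rw [hS.psiKappa_eq hT hg admissible_ω hα.1]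
  refine hz _ (admissible_ω.mul (hS.admissible_qoFilter hT hg hα.1)) α hα.1.le fun t ht => ?_
  rw [mul_assoc]
  exact (mul_le_mul_of_nonneg_left (hS.iInf_qoFilter_mul_le ht hα) (hω0 t ht).le).trans
    (le_abs_self _)

lemma exists_norm_propagated_noise_le (hS : StructuralAssumption T g φ κ)
    (hT : Function.Injective T) (hg : ∀ α > 0, ContinuousOn (g α) (Ioi 0))
    (hκ : IsIndexFunction κ) (hω : IsIndexFunction ω) (hω0 : ∀ t > 0, 0 < ω t)
    (hmono : MonotoneOn (fun t => κ t / ω t) (Ioi 0)) {c : ℝ} (hc : 0 ≤ c) :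
    ∃ C > 0, ∀ e : Y, MuckenhouptAt (TstarT T) κ c (adjoint T e) → ∀ α > 0,
      ‖funCalc (TstarT T) κ (regSol T g α e)‖ ≤ C * (κ α / ω α * psiKappa T g ω α e) := by
  obtain ⟨C₄, hC₄, filter_le⟩ := hS.exists_filter_le
  obtain ⟨c₃, hc₃, le_qoFilter⟩ := hS.exists_le_qoFilter hg
  have hp := isPositive_TstarT T
  have hinj := injective_TstarT hT
  have admissible_κ := hκ.admissible hp hinj
  have admissible_ω := hω.admissible hp hinj
  refine ⟨√(C₄ ^ 2 + c) / c₃, by positivity, fun e he α hα => ?_⟩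
  have admissible_g := hS.admissible_filter hT hg hα
  have ratio_nonneg : 0 ≤ κ α / ω α := div_nonneg (hκ.nonneg α hα) (hω0 α hα).le
  rw [regSol, ← funCalc_mul hp admissible_κ admissible_g, hS.psiKappa_eq hT hg admissible_ω hα]
  refine (he.norm_funCalc_le hp hinj hc admissible_κ (admissible_κ.mul admissible_g)
    (admissible_ω.mul (hS.admissible_qoFilter hT hg hα)) hα (D := κ α / ω α / c₃) (C := C₄)
    (by positivity) (fun t ht => ?near) (fun t ht => ?far) fun t ht => ?lower).trans_eq (by ring)
  case near =>
    rw [abs_mul, mul_comm, abs_of_nonneg (hS.filter_nonneg hα ht.1)]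
    exact mul_le_mul_of_nonneg_right (filter_le α hα t ht.1) (abs_nonneg _)
  case far =>
    have t_pos : 0 < t := hα.trans ht
    rw [abs_mul, abs_mul, mul_comm, abs_of_nonneg (hS.filter_nonneg hα t_pos),
      abs_of_pos (inv_pos.2 t_pos)]
    exact mul_le_mul_of_nonneg_right (hS.filter_le_inv hα t_pos) (abs_nonneg _)
  case lower =>
    have ωt_pos := hω0 t ht.1
    rw [abs_of_nonneg (hκ.nonneg t ht.1),
      abs_of_nonneg (mul_nonneg ωt_pos.le (hS.qoFilter_nonneg hα ht.1))]
    calc κ t = κ t / ω t * ω t := (div_mul_cancel₀ _ ωt_pos.ne').symm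
      _ ≤ κ α / ω α * ω t := mul_le_mul_of_nonneg_right (hmono ht.1 hα ht.2) ωt_pos.le
      _ = κ α / ω α / c₃ * α * (ω t * (c₃ / α)) := by field_simp
      _ ≤ κ α / ω α / c₃ * α * (ω t * qoFilter g α t) := by
          gcongr
          exact le_qoFilter α hα t ht

lemma regSol_exact (hS : StructuralAssumption T g φ κ) (hT : Function.Injective T)
    (hg : ∀ α > 0, ContinuousOn (g α) (Ioi 0)) (hα : 0 < α) (x : X) :
    regSol T g α (T x) = x - funCalc (TstarT T) (fun t => 1 - t * g α t) x := by
  have hp := isPositive_TstarT T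
  have admissible_g := hS.admissible_filter hT hg hα
  have commute : TstarT T (funCalc (TstarT T) (g α) x)
      = funCalc (TstarT T) (g α) (TstarT T x) := by
    have mul_id := funCalc_mul hp admissible_g (.id _) x
    have id_mul := funCalc_mul hp (.id _) admissible_g x
    rw [funCalc_id hp] at mul_id id_mul
    simp only [← id_mul, ← mul_id, mul_comm]
  rw [hS.funCalc_residual hT hg hα, sub_sub_cancel, commute]
  rfl

lemma exists_norm_error_le (hS : StructuralAssumption T g φ κ) (hT : Function.Injective T)
    (hg : ∀ α > 0, ContinuousOn (g α) (Ioi 0)) (hφ : IsIndexFunction φ) (hκ : IsIndexFunction κ)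
    (w : X) :
    ∃ C > 0, ∀ α > 0, ∀ z : Y,
      ‖funCalc (TstarT T) κ (regSol T g α z - funCalc (TstarT T) φ w)‖
        ≤ ‖funCalc (TstarT T) κ (regSol T g α (z - T (funCalc (TstarT T) φ w)))‖
          + C * (κ α * φ α) := by
  obtain ⟨c, hc, qualification⟩ := hS.qualification_kappa
  have hp := isPositive_TstarT T
  have hinj := injective_TstarT hT
  refine ⟨c * (‖w‖ + 1), by positivity, fun α hα z => ?_⟩
  have admissible_r := hS.admissible_residual hT hg hα
  have κφ_nonneg : 0 ≤ κ α * φ α := mul_nonneg (hκ.nonneg α hα) (hφ.nonneg α hα)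
  have bias_le : ‖funCalc (TstarT T) κ (funCalc (TstarT T) (fun t => 1 - t * g α t)
      (funCalc (TstarT T) φ w))‖ ≤ c * (‖w‖ + 1) * (κ α * φ α) := by
    rw [← funCalc_mul hp admissible_r (hφ.admissible hp hinj),
      ← funCalc_mul hp (hκ.admissible hp hinj) (admissible_r.mul (hφ.admissible hp hinj))]
    calc _ ≤ c * (κ α * φ α) * ‖w‖ := by
          refine norm_funCalc_le hp hinj ((hκ.admissible hp hinj).mul
            (admissible_r.mul (hφ.admissible hp hinj))) (fun t ht => ?_) w
          rw [mul_comm (1 - _), ← mul_assoc]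
          exact qualification α hα t ht
      _ ≤ c * (κ α * φ α) * (‖w‖ + 1) := by gcongr; exact le_add_of_nonneg_right zero_le_one
      _ = c * (‖w‖ + 1) * (κ α * φ α) := by ring
  have error_eq (x : X) : regSol T g α z - x = regSol T g α (z - T x)
      - funCalc (TstarT T) (fun t => 1 - t * g α t) x := by
    have regSol_Tx := hS.regSol_exact hT hg hα x
    simp only [regSol, map_sub] at regSol_Tx ⊢
    rw [regSol_Tx]
    abel
  rw [error_eq, map_sub]
  exact (norm_sub_le _ _).trans (by gcongr)

lemma exists_norm_error_le_psiKappa (hSκ : StructuralAssumption T g φ κ)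
    (hSω : StructuralAssumption T g φ ω) (hT : Function.Injective T)
    (hg : ∀ α > 0, ContinuousOn (g α) (Ioi 0)) (hφ : IsIndexFunction φ) (hκ : IsIndexFunction κ)
    (hω : IsIndexFunction ω) (hω0 : ∀ t > 0, 0 < ω t)
    (hmono : MonotoneOn (fun t => κ t / ω t) (Ioi 0)) {c : ℝ} (hc : 0 ≤ c) (w : X) :
    ∃ C > 0, ∀ α > 0, ∀ z : Y,
      MuckenhouptAt (TstarT T) κ c (adjoint T (z - T (funCalc (TstarT T) φ w))) →
      ‖funCalc (TstarT T) κ (regSol T g α z - funCalc (TstarT T) φ w)‖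
        ≤ C * (κ α / ω α * psiKappa T g ω α z + κ α * φ α) := by
  obtain ⟨C₁, hC₁, error_le⟩ := hSκ.exists_norm_error_le hT hg hφ hκ w
  obtain ⟨C₂, hC₂, noise_le⟩ := hSκ.exists_norm_propagated_noise_le hT hg hκ hω hω0 hmono hc
  obtain ⟨C₃, hC₃, exact_le⟩ := hSω.exists_psiKappa_exact_le hT hg hφ hω w
  refine ⟨C₂ + C₂ * C₃ + C₁, by positivity, fun α hα z hz => ?_⟩
  set x := funCalc (TstarT T) φ w
  have ωα_pos := hω0 α hα
  have κα_nonneg := hκ.nonneg α hα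
  have φα_nonneg := hφ.nonneg α hα
  have psi_nonneg : 0 ≤ psiKappa T g ω α z := norm_nonneg _
  calc _ ≤ ‖funCalc (TstarT T) κ (regSol T g α (z - T x))‖ + C₁ * (κ α * φ α) := error_le α hα z
    _ ≤ C₂ * (κ α / ω α * (psiKappa T g ω α z + C₃ * (ω α * φ α))) + C₁ * (κ α * φ α) := by
        refine add_le_add_left ((noise_le _ hz α hα).trans ?_) _
        gcongr
        exact (psiKappa_sub_le T g ω α z _).trans (add_le_add_right (exact_le α hα) _)
    _ = C₂ * (κ α / ω α * psiKappa T g ω α z) + (C₂ * C₃ + C₁) * (κ α * φ α) := by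
        field_simp
        ring
    _ ≤ (C₂ + C₂ * C₃ + C₁) * (κ α / ω α * psiKappa T g ω α z + κ α * φ α) := by
        rw [mul_add]
        gcongr
        · rw [add_assoc]
          exact le_add_of_nonneg_right (by positivity)
        · exact le_add_of_nonneg_left hC₂.le

end StructuralAssumption

end QuasiOptimality

/-! ### Convergence rates -/

section Rates

variable {φ κ : ℝ → ℝ} {a δ : ℝ}

lemma continuousOn_theta (hφ : IsIndexFunction φ) : ContinuousOn (theta φ) (Ioi 0) :=
  hφ.continuousOn.mul Real.continuous_sqrt.continuousOn

lemma strictMonoOn_theta (hφ : IsIndexFunction φ) (hφ0 : ∀ t > 0, 0 < φ t) :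
    StrictMonoOn (theta φ) (Ioi 0) := fun s hs t ht hst =>
  mul_lt_mul' (hφ.monotoneOn hs ht hst.le) (Real.sqrt_lt_sqrt (le_of_lt hs) hst)
    (Real.sqrt_nonneg s) (hφ0 t ht)

lemma tendsto_theta_nhdsGT_zero (hφ : IsIndexFunction φ) :
    Tendsto (theta φ) (𝓝[>] 0) (𝓝 0) := by
  have bound_tendsto : Tendsto (fun t => φ 1 * √t) (𝓝[>] 0) (𝓝 0) := by
    have continuous_bound : Continuous fun t => φ 1 * √t := by fun_prop
    simpa using continuous_bound.continuousWithinAt (s := Ioi 0) (x := 0) |>.tendsto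
  refine tendsto_of_tendsto_of_tendsto_of_le_of_le' tendsto_const_nhds bound_tendsto ?_ ?_
  · filter_upwards [self_mem_nhdsWithin] with t ht
    exact mul_nonneg (hφ.nonneg t ht) (Real.sqrt_nonneg t)
  · filter_upwards [Ioo_mem_nhdsGT one_pos] with t ht
    exact mul_le_mul_of_nonneg_right (hφ.monotoneOn ht.1 (mem_Ioi.2 one_pos) ht.2.le)
      (Real.sqrt_nonneg t)

lemma tendsto_theta_atTop (hφ : IsIndexFunction φ) (hφ0 : ∀ t > 0, 0 < φ t) :
    Tendsto (theta φ) atTop atTop := by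
  refine tendsto_atTop_mono' _ ?_ (Real.tendsto_sqrt_atTop.const_mul_atTop (hφ0 1 one_pos))
  filter_upwards [eventually_ge_atTop 1] with t ht
  exact mul_le_mul_of_nonneg_right
    (hφ.monotoneOn (mem_Ioi.2 one_pos) (mem_Ioi.2 (one_pos.trans_le ht)) ht) (Real.sqrt_nonneg t)

lemma mem_theta_image (hφ : IsIndexFunction φ) (hφ0 : ∀ t > 0, 0 < φ t) (hδ : 0 < δ) :
    δ ∈ theta φ '' Ioi 0 :=
  isPreconnected_Ioi.intermediate_value_Ioi (l₁ := 𝓝[>] 0) inf_le_right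
    (le_principal_iff.2 (Ioi_mem_atTop 0)) (continuousOn_theta hφ) (tendsto_theta_nhdsGT_zero hφ)
    (tendsto_theta_atTop hφ hφ0) hδ

lemma thetaInv_pos (hφ : IsIndexFunction φ) (hφ0 : ∀ t > 0, 0 < φ t) (hδ : 0 < δ) :
    0 < thetaInv φ δ :=
  Function.invFunOn_mem (mem_theta_image hφ hφ0 hδ)

lemma theta_thetaInv (hφ : IsIndexFunction φ) (hφ0 : ∀ t > 0, 0 < φ t) (hδ : 0 < δ) :
    theta φ (thetaInv φ δ) = δ :=
  Function.invFunOn_eq (mem_theta_image hφ hφ0 hδ)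

lemma eventually_thetaInv_le (hφ : IsIndexFunction φ) (hφ0 : ∀ t > 0, 0 < φ t) (ha : 0 < a) :
    ∀ᶠ δ in 𝓝[>] 0, thetaInv φ δ ≤ a := by
  have theta_pos : 0 < theta φ a := mul_pos (hφ0 a ha) (Real.sqrt_pos.2 ha)
  filter_upwards [Ioo_mem_nhdsGT theta_pos] with δ hδ
  rw [← (strictMonoOn_theta hφ hφ0).le_iff_le (thetaInv_pos hφ hφ0 hδ.1) ha,
    theta_thetaInv hφ hφ0 hδ.1]
  exact hδ.2.le

lemma exists_le_mul_of_regular_variation {ρ : ℝ → ℝ} {K c δ₀ : ℝ} (hρ : MonotoneOn ρ (Ioi 0))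
    (hρ0 : ∀ t > 0, 0 < ρ t) (ha : 0 < a) (hδ₀ : 0 < δ₀)
    (variation : ∀ s ∈ Ioo 0 δ₀, ρ (K * s) ≤ c * ρ s) :
    ∃ C > 0, ∀ α ∈ Ioc 0 a, ∀ s > 0, α ≤ K * s → ρ α ≤ C * ρ s := by
  have ρδ₀_pos := hρ0 δ₀ hδ₀
  have ρa_pos := hρ0 a ha
  refine ⟨max c (ρ a / ρ δ₀), lt_max_of_lt_right (by positivity), fun α hα s hs hαs => ?_⟩
  have ρs_pos := hρ0 s hs
  rcases lt_or_ge s δ₀ with small | large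
  · calc ρ α ≤ ρ (K * s) := hρ hα.1 (hα.1.trans_le hαs) hαs
      _ ≤ c * ρ s := variation s ⟨hs, small⟩
      _ ≤ max c (ρ a / ρ δ₀) * ρ s := by gcongr; exact le_max_left _ _
  · calc ρ α ≤ ρ a := hρ hα.1 ha hα.2
      _ = ρ a / ρ δ₀ * ρ δ₀ := (div_mul_cancel₀ _ ρδ₀_pos.ne').symm
      _ ≤ max c (ρ a / ρ δ₀) * ρ s :=
          mul_le_mul (le_max_right _ _) (hρ hδ₀ hs large) ρδ₀_pos.le
            (le_max_of_le_right (by positivity))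

lemma StructuralAssumption.exists_kappa_mul_phi_le {𝕜 X Y : Type*} [RCLike 𝕜]
    [NormedAddCommGroup X] [InnerProductSpace 𝕜 X] [NormedAddCommGroup Y] [InnerProductSpace 𝕜 Y]
    {T : X →L[𝕜] Y} {g : ℝ → ℝ → ℝ} (hS : StructuralAssumption T g φ κ)
    (hφ : IsIndexFunction φ) (hκ : IsIndexFunction κ) (hφ0 : ∀ t > 0, 0 < φ t)
    (hκ0 : ∀ t > 0, 0 < κ t) (ha : 0 < a) {K : ℝ} (hK : 0 < K) :
    ∃ C > 0, ∀ α ∈ Ioc 0 a, ∀ s > 0, α ≤ K * s → (κ * φ) α ≤ C * (κ * φ) s := by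
  obtain ⟨c, hc, δ₀, hδ₀, variation⟩ := hS.regular_variation K hK
  refine exists_le_mul_of_regular_variation (c := c * c)
    (hκ.monotoneOn.mul hφ.monotoneOn hκ.nonneg hφ.nonneg)
    (fun t ht => mul_pos (hκ0 t ht) (hφ0 t ht)) ha hδ₀ fun s hs => ?_
  obtain ⟨φ_le, κ_le⟩ := variation s hs
  have κs_nonneg := hκ.nonneg s hs.1
  calc κ (K * s) * φ (K * s) ≤ c * κ s * (c * φ s) :=
        mul_le_mul κ_le φ_le (hφ.nonneg _ (mul_pos hK hs.1)) (by positivity)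
    _ = c * c * (κ s * φ s) := by ring

end Rates

section QuasiOptimalityRates

variable {𝕜 X Y : Type*} [RCLike 𝕜]
  [NormedAddCommGroup X] [InnerProductSpace 𝕜 X] [CompleteSpace X]
  [NormedAddCommGroup Y] [InnerProductSpace 𝕜 Y] [CompleteSpace Y]
  {T : X →L[𝕜] Y} {g : ℝ → ℝ → ℝ} {φ κ ω : ℝ → ℝ} {a : ℝ}

open ContinuousLinearMap (adjoint)

namespace StructuralAssumption

/-- At `s = θ⁻¹(δ)` the noise term `δ / √s` of `ψ_ω` equals its approximation term `φ(s)`. -/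
lemma exists_psiKappa_argmin_le (hS : StructuralAssumption T g φ ω) (hT : Function.Injective T)
    (hg : ∀ α > 0, ContinuousOn (g α) (Ioi 0)) (hφ : IsIndexFunction φ) (hω : IsIndexFunction ω)
    (hφ0 : ∀ t > 0, 0 < φ t) (w : X) :
    ∃ C > 0, ∀ δ > 0, thetaInv φ δ ≤ a → ∀ z, ‖z - T (funCalc (TstarT T) φ w)‖ ≤ δ →
      ∀ α, IsArgmin (fun β => psiKappa T g ω β z) a α →
        psiKappa T g ω α z ≤ C * (ω * φ) (thetaInv φ δ) := by
  obtain ⟨C₁, hC₁, noise_le⟩ := hS.exists_psiKappa_le hT hg hω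
  obtain ⟨C₂, hC₂, exact_le⟩ := hS.exists_psiKappa_exact_le hT hg hφ hω w
  refine ⟨C₁ + C₂, by positivity, fun δ hδ s_le z hz α hα => ?_⟩
  have s_pos := thetaInv_pos hφ hφ0 hδ
  have theta_s := theta_thetaInv hφ hφ0 hδ
  set s := thetaInv φ δ
  have ωs_nonneg := hω.nonneg s s_pos
  calc psiKappa T g ω α z ≤ psiKappa T g ω s z := hα.2 s ⟨s_pos, s_le⟩
    _ ≤ psiKappa T g ω s (z - T (funCalc (TstarT T) φ w))
        + psiKappa T g ω s (T (funCalc (TstarT T) φ w)) := psiKappa_le_sub_add T g ω s z _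
    _ ≤ C₁ * (ω s / √s) * δ + C₂ * (ω s * φ s) := by
        refine add_le_add ((noise_le s s_pos _).trans ?_) (exact_le s s_pos)
        gcongr
    _ = C₁ * (ω s / √s) * (φ s * √s) + C₂ * (ω s * φ s) := by rw [← theta_s, theta]
    _ = (C₁ + C₂) * (ω s * φ s) := by field_simp

lemma phi_pos_of_funCalc_ne_zero (hS : StructuralAssumption T g φ κ) (hT : Function.Injective T)
    (hφ : IsIndexFunction φ) {w : X} (hw : funCalc (TstarT T) φ w ≠ 0) :
    ∀ t > 0, 0 < φ t := by
  have hp := isPositive_TstarT T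
  have hinj := injective_TstarT hT
  have norm_pos : 0 < ‖T‖ := norm_pos_iff.2 fun T_zero => hw (hT (by simp [T_zero]))
  refine fun t ht => hS.phi_pos hφ norm_pos ?_ ht
  by_contra! φ_zero
  refine hw (norm_le_zero_iff.1 ?_)
  simpa using norm_funCalc_le hp hinj (hφ.admissible hp hinj) (C := 0)
    (fun t ht => by rw [φ_zero t ht, abs_zero]) w

lemma exists_eventually_norm_error_le (hSκ : StructuralAssumption T g φ κ)
    (hSω : StructuralAssumption T g φ ω) (hT : Function.Injective T)
    (hg : ∀ α > 0, ContinuousOn (g α) (Ioi 0)) (hφ : IsIndexFunction φ) (hκ : IsIndexFunction κ)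
    (hω : IsIndexFunction ω) (hκ0 : ∀ t > 0, 0 < κ t) (hω0 : ∀ t > 0, 0 < ω t)
    (hmono : MonotoneOn (fun t => κ t / ω t) (Ioi 0)) {w : X}
    (hw : funCalc (TstarT T) φ w ≠ 0) {yδ : ℝ → Y}
    (hyδ : ∀ᶠ δ in 𝓝[>] 0, ‖yδ δ - T (funCalc (TstarT T) φ w)‖ ≤ δ) {c : ℝ} (hc : 0 ≤ c)
    (hM : ∀ᶠ δ in 𝓝[>] 0,
      MuckenhouptAt (TstarT T) κ c (adjoint T (yδ δ - T (funCalc (TstarT T) φ w))))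
    (ha : 0 < a) (haT : a ≤ ‖T‖) :
    ∃ C > 0, ∀ᶠ δ in 𝓝[>] 0, ∀ α, IsArgmin (fun β => psiKappa T g ω β (yδ δ)) a α →
      ‖funCalc (TstarT T) κ (regSol T g α (yδ δ) - funCalc (TstarT T) φ w)‖
        ≤ C * max ((κ * φ) ((ω * φ) (thetaInv φ δ))) ((ω * φ) (thetaInv φ δ)) := by
  set x := funCalc (TstarT T) φ w
  have hφ0 := hSκ.phi_pos_of_funCalc_ne_zero hT hφ hw
  have adjoint_ne_zero : adjoint T (T x) ≠ 0 := (map_ne_zero_iff _ (injective_TstarT hT)).2 hw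
  have yδ_tendsto : Tendsto yδ (𝓝[>] 0) (𝓝 (T x)) :=
    tendsto_iff_norm_sub_tendsto_zero.2 (squeeze_zero' (.of_forall fun _ => norm_nonneg _) hyδ
      nhdsWithin_le_nhds)
  obtain ⟨C₁, hC₁, error_le⟩ :=
    hSκ.exists_norm_error_le_psiKappa hSω hT hg hφ hκ hω hω0 hmono hc w
  obtain ⟨C₂, hC₂, argmin_le⟩ := hSω.exists_psiKappa_argmin_le (a := a) hT hg hφ hω hφ0 w
  obtain ⟨c₃, hc₃, le_psi⟩ := hSω.exists_eventually_le_psiKappa hT hg hω hω0 adjoint_ne_zero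
  obtain ⟨C₄, hC₄, variation⟩ :=
    hSκ.exists_kappa_mul_phi_le hφ hκ hφ0 hκ0 ha (div_pos hC₂ hc₃)
  have ratio_pos : 0 < κ a / ω a := div_pos (hκ0 a ha) (hω0 a ha)
  refine ⟨C₁ * (κ a / ω a * C₂ + C₄), by positivity, ?_⟩
  filter_upwards [self_mem_nhdsWithin, hyδ, hM, eventually_thetaInv_le hφ hφ0 ha,
    yδ_tendsto.eventually le_psi] with δ hδ noise muckenhoupt s_le le_psi α hα
  have s_pos := thetaInv_pos hφ hφ0 hδ
  set r := (ω * φ) (thetaInv φ δ)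
  have r_pos : 0 < r := mul_pos (hω0 _ s_pos) (hφ0 _ s_pos)
  have psi_le : psiKappa T g ω α (yδ δ) ≤ C₂ * r := argmin_le δ hδ s_le _ noise α hα
  have α_le : α ≤ C₂ / c₃ * r := by
    rw [div_mul_eq_mul_div, le_div_iff₀' hc₃]
    exact (le_psi α ⟨hα.1.1, hα.1.2.trans haT⟩).trans psi_le
  calc _ ≤ C₁ * (κ α / ω α * psiKappa T g ω α (yδ δ) + (κ * φ) α) := error_le α hα.1.1 _ muckenhoupt
    _ ≤ C₁ * (κ a / ω a * (C₂ * r) + C₄ * (κ * φ) r) := by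
        refine mul_le_mul_of_nonneg_left (add_le_add ?_ (variation α hα.1 r r_pos α_le)) hC₁.le
        exact mul_le_mul (hmono hα.1.1 ha hα.1.2) psi_le (norm_nonneg _) ratio_pos.le
    _ ≤ C₁ * (κ a / ω a * (C₂ * max ((κ * φ) r) r) + C₄ * max ((κ * φ) r) r) := by
        gcongr
        exacts [le_max_right _ _, le_max_left _ _]
    _ = C₁ * (κ a / ω a * C₂ + C₄) * max ((κ * φ) r) r := by ring

lemma exists_eventually_norm_inner_error_le (hSκ : StructuralAssumption T g φ κ)
    (hSω : StructuralAssumption T g φ ω) (hT : Function.Injective T)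
    (hg : ∀ α > 0, ContinuousOn (g α) (Ioi 0)) (hφ : IsIndexFunction φ) (hκ : IsIndexFunction κ)
    (hω : IsIndexFunction ω) (hκ0 : ∀ t > 0, 0 < κ t) (hω0 : ∀ t > 0, 0 < ω t)
    (hmono : MonotoneOn (fun t => κ t / ω t) (Ioi 0)) {w : X}
    (hw : funCalc (TstarT T) φ w ≠ 0) {yδ : ℝ → Y}
    (hyδ : ∀ᶠ δ in 𝓝[>] 0, ‖yδ δ - T (funCalc (TstarT T) φ w)‖ ≤ δ) {c : ℝ} (hc : 0 ≤ c)
    (hM : ∀ᶠ δ in 𝓝[>] 0,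
      MuckenhouptAt (TstarT T) κ c (adjoint T (yδ δ - T (funCalc (TstarT T) φ w))))
    (ha : 0 < a) (haT : a ≤ ‖T‖) (v : X) :
    ∃ C > 0, ∀ᶠ δ in 𝓝[>] 0, ∀ α, IsArgmin (fun β => psiKappa T g ω β (yδ δ)) a α →
      ‖⟪funCalc (TstarT T) κ v, regSol T g α (yδ δ) - funCalc (TstarT T) φ w⟫_𝕜‖
        ≤ C * max ((κ * φ) ((ω * φ) (thetaInv φ δ))) ((ω * φ) (thetaInv φ δ)) := by
  have hp := isPositive_TstarT T
  have admissible_κ := hκ.admissible hp (injective_TstarT hT)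
  obtain ⟨C, hC, error_le⟩ := hSκ.exists_eventually_norm_error_le hSω hT hg hφ hκ hω hκ0 hω0 hmono
    hw hyδ hc hM ha haT
  refine ⟨(‖v‖ + 1) * C, by positivity, error_le.mono fun δ error_le α hα => ?_⟩
  calc _ ≤ ‖v‖ * ‖funCalc (TstarT T) κ (regSol T g α (yδ δ) - funCalc (TstarT T) φ w)‖ :=
        norm_inner_funCalc_le hp admissible_κ v _
    _ ≤ (‖v‖ + 1) * ‖funCalc (TstarT T) κ (regSol T g α (yδ δ) - funCalc (TstarT T) φ w)‖ := by
        gcongr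
        exact le_add_of_nonneg_right zero_le_one
    _ ≤ (‖v‖ + 1) * (C * max ((κ * φ) ((ω * φ) (thetaInv φ δ))) ((ω * φ) (thetaInv φ δ))) := by
        gcongr
        exact error_le α hα
    _ = _ := (mul_assoc _ _ _).symm

end StructuralAssumption

end QuasiOptimalityRates

end

end FunctionalStrategy

open FunctionalStrategy in
theorem theorem2p1_general
    {𝕜 X Y : Type*} [RCLike 𝕜]
    [NormedAddCommGroup X] [InnerProductSpace 𝕜 X] [CompleteSpace X]
    [NormedAddCommGroup Y] [InnerProductSpace 𝕜 Y] [CompleteSpace Y]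
    (T : X →L[𝕜] Y) (hT : Function.Injective T)
    (g : ℝ → ℝ → ℝ)
    (hg : ∀ α > 0, ContinuousOn (g α) (Ioi 0))
    (φ κ : ℝ → ℝ)
    (hφ : IsIndexFunction φ)
    (hκ : IsIndexFunction κ) (hκ0 : ∃ t > 0, κ t ≠ 0)
    (hA : StructuralAssumption T g φ κ)
    (x f : X) (y : Y) (hxy : T x = y) (hy : y ≠ 0)
    (hx : x ∈ range (funCalc (TstarT T) φ))
    (hf : f ∈ range (funCalc (TstarT T) κ))
    (yδ : ℝ → Y) (hyδ : ∀ δ ∈ Ioo (0 : ℝ) 1, ‖yδ δ - y‖ ≤ δ)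
    (hN : NoiseCondition T κ y yδ)
    (a : ℝ) (ha : 0 < a) (haT : a ≤ ‖T‖) :
    (∃ C > 0, ∀ᶠ δ in 𝓝[>] (0 : ℝ), ∀ α : ℝ,
      IsArgmin (fun β => psi T g β (yδ δ)) a α →
      ‖regSol T g α (yδ δ) - x‖
        ≤ C * max (φ (φ (thetaInv φ δ)))
            (φ (thetaInv φ δ))) ∧
    (∃ C > 0, ∀ᶠ δ in 𝓝[>] (0 : ℝ), ∀ α : ℝ,
      IsArgmin (fun β => psi T g β (yδ δ)) a α →
      ‖inner 𝕜 f (regSol T g α (yδ δ) - x)‖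
        ≤ C * max ((κ * φ) (φ (thetaInv φ δ)))
            (φ (thetaInv φ δ))) ∧
    (∃ C > 0, ∀ᶠ δ in 𝓝[>] (0 : ℝ), ∀ α : ℝ,
      IsArgmin (fun β => psiKappa T g κ β (yδ δ)) a α →
      ‖inner 𝕜 f (regSol T g α (yδ δ) - x)‖
        ≤ C * max ((κ * φ) ((κ * φ) (thetaInv φ δ)))
            ((κ * φ) (thetaInv φ δ))) := by
  obtain ⟨w, rfl⟩ := hx
  obtain ⟨v, rfl⟩ := hf
  subst hxy
  have hp := isPositive_TstarT T
  have hinj := injective_TstarT hT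
  have hw : funCalc (TstarT T) φ w ≠ 0 := fun x_zero => hy (by rw [x_zero, map_zero])
  have κ_pos : ∀ t > 0, 0 < κ t := fun t ht => hA.kappa_pos hκ hκ0 ht
  have one_weight_pos : ∀ t > (0 : ℝ), 0 < (1 : ℝ → ℝ) t := fun _ _ => one_pos
  have div_one_mono : MonotoneOn (fun t => κ t / (1 : ℝ → ℝ) t) (Ioi 0) := by
    simpa only [Pi.one_apply, div_one] using hκ.monotoneOn
  have noise := eventually_of_mem (Ioo_mem_nhdsGT one_pos) hyδ
  obtain ⟨c, hc, muckenhoupt⟩ := hN.exists_muckenhouptAt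
  have muckenhoupt_one := muckenhoupt.mono fun δ hM => hM.of_monotoneOn_div hp hinj hc.le
    (hκ.admissible hp hinj) (isIndexFunction_one.admissible hp hinj) κ_pos one_weight_pos
    div_one_mono
  refine ⟨?_, ?_, ?_⟩
  · simpa only [one_mul, psi_eq_psiKappa_one, funCalc_one hp, one_apply_eq_self] using
      (hA.one hφ).exists_eventually_norm_error_le (hA.one hφ) hT hg hφ isIndexFunction_one
        isIndexFunction_one one_weight_pos one_weight_pos (by simp [monotoneOn_const]) hw noise
        hc.le muckenhoupt_one ha haT
  · simpa only [one_mul, psi_eq_psiKappa_one] using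
      hA.exists_eventually_norm_inner_error_le (hA.one hφ) hT hg hφ hκ isIndexFunction_one κ_pos
        one_weight_pos div_one_mono hw noise hc.le muckenhoupt ha haT v
  · exact hA.exists_eventually_norm_inner_error_le hA hT hg hφ hκ hκ κ_pos κ_pos
      (monotoneOn_const.congr fun t ht => (div_self (κ_pos t ht).ne').symm) hw noise hc.le
      muckenhoupt ha haT v

theorem theorem2p1
    {𝕜 X Y : Type*} [RCLike 𝕜]
    [NormedAddCommGroup X] [InnerProductSpace 𝕜 X] [CompleteSpace X]
    [NormedAddCommGroup Y] [InnerProductSpace 𝕜 Y] [CompleteSpace Y]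
    (T : X →L[𝕜] Y) (hT : Function.Injective T)
    (hT' : Function.Injective (ContinuousLinearMap.adjoint T))
    (g : ℝ → ℝ → ℝ)
    (hg : ContinuousOn (fun p : ℝ × ℝ => g p.1 p.2) (Set.Ioi 0 ×ˢ Set.Ioi 0))
    (φ κ : ℝ → ℝ)
    (hφ : FunctionalStrategy.IsIndexFunction φ)
    (hκ : FunctionalStrategy.IsIndexFunction κ) (hκ0 : ∃ t > 0, κ t ≠ 0)
    (hA : FunctionalStrategy.StructuralAssumption T g φ κ)
    (x f : X) (y : Y) (hxy : T x = y) (hy : y ≠ 0)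
    (hx : x ∈ Set.range (FunctionalStrategy.funCalc (FunctionalStrategy.TstarT T) φ))
    (hf : f ∈ Set.range (FunctionalStrategy.funCalc (FunctionalStrategy.TstarT T) κ))
    (yδ : ℝ → Y) (hyδ : ∀ δ ∈ Set.Ioo (0 : ℝ) 1, ‖yδ δ - y‖ ≤ δ)
    (hN : FunctionalStrategy.NoiseCondition T κ y yδ)
    (a : ℝ) (ha : 0 < a) (haT : a ≤ ‖T‖) :
    (∃ C > 0, ∀ᶠ δ in 𝓝[>] (0 : ℝ), ∀ α : ℝ,
      FunctionalStrategy.IsArgmin (fun β => FunctionalStrategy.psi T g β (yδ δ)) a α →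
      ‖FunctionalStrategy.regSol T g α (yδ δ) - x‖
        ≤ C * max (φ (φ (FunctionalStrategy.thetaInv φ δ)))
            (φ (FunctionalStrategy.thetaInv φ δ))) ∧
    (∃ C > 0, ∀ᶠ δ in 𝓝[>] (0 : ℝ), ∀ α : ℝ,
      FunctionalStrategy.IsArgmin (fun β => FunctionalStrategy.psi T g β (yδ δ)) a α →
      ‖inner 𝕜 f (FunctionalStrategy.regSol T g α (yδ δ) - x)‖
        ≤ C * max ((κ * φ) (φ (FunctionalStrategy.thetaInv φ δ)))
            (φ (FunctionalStrategy.thetaInv φ δ))) ∧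
    (∃ C > 0, ∀ᶠ δ in 𝓝[>] (0 : ℝ), ∀ α : ℝ,
      FunctionalStrategy.IsArgmin (fun β => FunctionalStrategy.psiKappa T g κ β (yδ δ)) a α →
      ‖inner 𝕜 f (FunctionalStrategy.regSol T g α (yδ δ) - x)‖
        ≤ C * max ((κ * φ) ((κ * φ) (FunctionalStrategy.thetaInv φ δ)))
            ((κ * φ) (FunctionalStrategy.thetaInv φ δ))) := by
  exact theorem2p1_general T hT g (fun α hα => hg.comp (f := fun t => (α, t)) (by fun_prop)
    fun t ht => ⟨hα, ht⟩) φ κ hφ hκ hκ0 hA x f y hxy hy hx hf yδ hyδ hN a ha haT
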